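/- Fix integers $s\ge 1$ and $l\ge 0$. **Fock space and fermions.** Let $\Lambda=\mathbb C[p^{(a)}_n:\ 1\le a\le s,\ n\ge1]$ and $\mathcal B=\Lambda[z_1^{\pm1},\dots,z_s^{\pm1}]$; an element is written $\tau=\sum_{m\in\mathbb Z^s}z^m\tau_m$ with $\tau_m\in\Lambda$ and $z^m=z_1^{m_1}\cdots z_s^{m_s}$, and it has charge $c$ if only $m$ with $|m|=m_1+\dots+m_s=c$ occur. Put $$H^{(a)}(u)=\sum_{k\ge0}h^{(a)}_ku^k=\exp\Big(\sum_{n\ge1}\tfrac{p^{(a)}_n}{n}u^n\Big),\qquad E^{(a)}(u)=\sum_{k\ge0}e^{(a)}_ku^k=\exp\Big(-\sum_{n\ge1}\tfrac{(-1)^np^{(a)}_n}{n}u^n\Big),$$ $$H^{(a)\perp}(u)=\exp\Big(\sum_{n\ge1}\tfrac{\partial}{\partial p^{(a)}_n}u^{-n}\Big),\qquad E^{(a)\perp}(u)=\exp\Big(-\sum_{n\ge1}(-1)^n\tfrac{\partial}{\partial p^{(a)}_n}u^{-n}\Big),$$ and $R^{\pm(a)}(u)(z^mf)=(-1)^{m_1+\dots+m_{a-1}}z_a^{\pm1}z^mu^{\pm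 m_a}f$ for $f\in\Lambda$. The operators $\psi^{\pm(a)}_k$, $k\in\mathbb Z+\frac12$, on $\mathcal B$ are defined by $\psi^{\pm(a)}(u)=\sum_k\psi^{\pm(a)}_ku^{-k-1/2}$, where $$\psi^{+(a)}(u)=R^{+(a)}(u)H^{(a)}(u)E^{(a)\perp}(-u),\qquad \psi^{-(a)}(u)=R^{-(a)}(u)E^{(a)}(-u)H^{(a)\perp}(u).$$ Let $\Omega=\sum_{a=1}^s\sum_{k\in\mathbb Z+1/2}\psi^{+(a)}_k\otimes\psi^{-(a)}_{-k}$ on $\mathcal B\otimes_{\mathbb C}\mathcal B$ (on each vector only finitely many terms are non-zero). A tau-function of charge $c$ of the $s$-component KP hierarchy is a non-zero $\tau\in\mathcal B$ of charge $c$ with $\Omega(\tau\otimes\tau)=0$. **Generating function.** Let $A^{(r)}_i(u)\in\mathbb C((u))$, $1\le i\le l$, $1\le r\le s$, be formal Laurent series, and put $T^{(r)}_i(u)=A^{(r)}_i(u)H^{(r)}(u)\in\Lambda((u))$. For $a_1,\dots,a_l\in\{1,\dots,s\}$ put $$T^{(a_l,\dots,a_1)}(u_1,\dots,u_l)=\prod_{i<j}(u_j-u_i)^{\delta_{a_i,a_j}}\prod_{j=1}^lT^{(a_j)}_j(u_j),$$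 let $\varepsilon(a_l,\dots,a_1)=(-1)^{\#\{(i,j)\,:\,i<j,\ a_i<a_j\}}$ (equivalently, $\varepsilon(a)=1$ and $\varepsilon(a,a_l,\dots,a_1)=(-1)^{\#\{i\,:\,a_i<a\}}\varepsilon(a_l,\dots,a_1)$), and put $$T(u_1,\dots,u_l)=\sum_{a_1,\dots,a_l=1}^s\varepsilon(a_l,\dots,a_1)\,z_{a_1}\cdots z_{a_l}\,T^{(a_l,\dots,a_1)}(u_1,\dots,u_l)\ \in\ \mathcal B[[u_1,\dots,u_l]][u_1^{-1},\dots,u_l^{-1}].$$ For $m\in\mathbb Z_{\ge0}^s$ with $|m|=l$ let $(a_1,\dots,a_l)=(1,\dots,1,2,\dots,2,\dots,s,\dots,s)$, with $r$ repeated $m_r$ times, and for $1\le j\le l$ let $\sigma_m(j)=j-\max\{m_1+\dots+m_r\,:\,0\le r<s,\ m_1+\dots+m_r<j\}$, so that $\sigma_m(j)$ is the position of $j$ inside its block of equal colours. **Theorem.** For every $\alpha=(\alpha_1,\dots,\alpha_l)\in\mathbb Z^l$, let $\tau=\sum_mz^m\tau_m\in\mathcal B$ be the coefficient of $u_1^{\alpha_1}\cdots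 u_l^{\alpha_l}$ in $T(u_1,\dots,u_l)$. If $\tau\neq0$, then $\tau$ is a tau-function of charge $l$ of the $s$-component KP hierarchy. Moreover, for $m\in\mathbb Z_{\ge0}^s$ with $|m|=l$, $\tau_m$ is the coefficient of $u_1^{\alpha_1}\cdots u_l^{\alpha_l}$ in $$T_m(u_1,\dots,u_l)=(-1)^{\sum_{i<j}m_im_j}\det\Big[u_i^{\sigma_m(j)-1}\,T^{(a_j)}_i(u_i)\Big]_{i,j=1,\dots,l},$$ and $\tau_m=0$ for all other $m\in\mathbb Z^s$. -/

import Mathlib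

noncomputable section

namespace MultiKP

open scoped TensorProduct

/-! ### The boson Fock space and symmetric functions -/

/-- The algebra `Λ⁽¹⁾ ⊗ ⋯ ⊗ Λ⁽ˢ⁾ = ℂ[p_n⁽ᵃ⁾ : 1 ≤ a ≤ s, n ≥ 1]`, written in the power sums. -/
abbrev Sym (s : ℕ) : Type := MvPolynomial (Fin s × ℕ+) ℂ

/-- The `s`-component boson Fock space
`ℂ[z_a, z_a⁻¹; p_1⁽ᵃ⁾, p_2⁽ᵃ⁾, … ; 1 ≤ a ≤ s]`, i.e. Laurent polynomials in `z_1, …, z_s`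
with coefficients in `Sym s`; `τ.coeff m` is the coefficient of `z^m = z_1^{m_1} ⋯ z_s^{m_s}`. -/
abbrev Fock (s : ℕ) : Type := AddMonoidAlgebra (Sym s) (Fin s → ℤ)

/-- The power sum `p_n⁽ᵃ⁾`. -/
def p {s : ℕ} (a : Fin s) (n : ℕ+) : Sym s := MvPolynomial.X (a, n)

/-- The adjoint `(p_n⁽ᵃ⁾)^⊥ = n ∂/∂p_n⁽ᵃ⁾` of multiplication by `p_n⁽ᵃ⁾`. -/
def pPerp {s : ℕ} (a : Fin s) (n : ℕ+) : Module.End ℂ (Sym s) :=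
  ((n : ℕ) : ℂ) • (MvPolynomial.pderiv (R := ℂ) (a, n)).toLinearMap

/-- The series `∑_{n ≥ 1} (x_n / n) w^n`. -/
def logSeries {R : Type*} [Ring R] [Algebra ℂ R] (x : ℕ+ → R) : PowerSeries R :=
  PowerSeries.mk fun n => if hn : 0 < n then ((n : ℂ)⁻¹) • x ⟨n, hn⟩ else 0

/-- The coefficient of `w^k` in `exp (∑_{n ≥ 1} (x_n / n) w^n) = ∑_j (1 / j!) (∑_n (x_n / n) w^n)^j`
(only `j ≤ k` contribute, since the exponent has no constant term). -/
def expCoeff {R : Type*} [Ring R] [Algebra ℂ R] (x : ℕ+ → R) (k : ℕ) : R :=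
  ∑ j ∈ Finset.range (k + 1),
    ((j.factorial : ℂ)⁻¹) • PowerSeries.coeff k ((logSeries x) ^ j)

/-- Complete symmetric functions: `H⁽ᵃ⁾(u) = ∑ h_k u^k = exp (∑ p_n u^n / n)`. -/
def h {s : ℕ} (a : Fin s) (k : ℕ) : Sym s := expCoeff (p a) k

/-- Elementary symmetric functions: `E⁽ᵃ⁾(u) = ∑ e_k u^k = exp (-∑ (-1)^n p_n u^n / n)`. -/
def e {s : ℕ} (a : Fin s) (k : ℕ) : Sym s :=
  expCoeff (fun n : ℕ+ => (-1 : ℂ) ^ ((n : ℕ) + 1) • p a n) k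

/-- The adjoint `h_k^⊥`: the polynomial expressing `h_k` through the `p_n`, evaluated at
`p_n^⊥ = n ∂/∂p_n`; thus `∑ h_k^⊥ u^{-k} = exp (∑ ∂/∂p_n u^{-n})`. -/
def hPerp {s : ℕ} (a : Fin s) (k : ℕ) : Module.End ℂ (Sym s) := expCoeff (pPerp a) k

/-- The adjoint `e_k^⊥`: the polynomial expressing `e_k` through the `p_n`, evaluated at
`p_n^⊥ = n ∂/∂p_n`; thus `∑ e_k^⊥ u^{-k} = exp (-∑ (-1)^n ∂/∂p_n u^{-n})`. -/
def ePerp {s : ℕ} (a : Fin s) (k : ℕ) : Module.End ℂ (Sym s) :=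
  expCoeff (fun n : ℕ+ => (-1 : ℂ) ^ ((n : ℕ) + 1) • pPerp a n) k

/-- `h_j` for `j ∈ ℤ`, zero for `j < 0`. -/
def hInt {s : ℕ} (a : Fin s) (j : ℤ) : Sym s := if 0 ≤ j then h a j.toNat else 0

/-- `e_j` for `j ∈ ℤ`, zero for `j < 0`. -/
def eInt {s : ℕ} (a : Fin s) (j : ℤ) : Sym s := if 0 ≤ j then e a j.toNat else 0

/-! ### Local nilpotency of the adjoint operators -/

/-- All monomials of `f` have degree at most `d`, where `p_n⁽ᵃ⁾` has degree `n`. -/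
def DegLE {s : ℕ} (d : ℤ) (f : Sym s) : Prop :=
  ∀ m, MvPolynomial.coeff m f ≠ 0 →
    ((Finsupp.weight (fun v : Fin s × ℕ+ => (v.2 : ℕ)) m : ℕ) : ℤ) ≤ d

/-- The operator `L` lowers the degree by at least `k`. -/
def Lowers {s : ℕ} (k : ℕ) (L : Module.End ℂ (Sym s)) : Prop :=
  ∀ (d : ℤ) (f : Sym s), DegLE d f → DegLE (d - k) (L f)

theorem DegLE.add {s : ℕ} {d : ℤ} {f g : Sym s} (hf : DegLE d f) (hg : DegLE d g) :
    DegLE d (f + g) := by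
  intro m hm
  by_cases h1 : MvPolynomial.coeff m f = 0
  · refine hg m fun h2 => hm ?_
    rw [MvPolynomial.coeff_add, h1, h2, add_zero]
  · exact hf m h1

theorem DegLE.smul {s : ℕ} {d : ℤ} {f : Sym s} (c : ℂ) (hf : DegLE d f) :
    DegLE d (c • f) := by
  intro m hm
  refine hf m fun h1 => hm ?_
  rw [MvPolynomial.coeff_smul, h1, smul_zero]

theorem DegLE.zero {s : ℕ} (d : ℤ) : DegLE d (0 : Sym s) := by
  intro m hm
  exact absurd (MvPolynomial.coeff_zero m) hm

theorem DegLE.exists_bound {s : ℕ} (f : Sym s) : ∃ d : ℕ, DegLE (d : ℤ) f := by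
  refine ⟨f.support.sup (fun m => Finsupp.weight (fun v : Fin s × ℕ+ => (v.2 : ℕ)) m), ?_⟩
  intro m hm
  have := Finset.le_sup (f := fun m => Finsupp.weight (fun v : Fin s × ℕ+ => (v.2 : ℕ)) m)
    (MvPolynomial.mem_support_iff.mpr hm)
  exact_mod_cast this

theorem DegLE.eq_zero {s : ℕ} {d : ℤ} (hd : d < 0) {f : Sym s} (hf : DegLE d f) : f = 0 := by
  ext m
  by_contra hm
  have := hf m (by simpa using hm)
  omega

theorem Lowers.zero {s : ℕ} (k : ℕ) : Lowers k (0 : Module.End ℂ (Sym s)) :=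
  fun d _ _ => DegLE.zero (d - k)

theorem Lowers.add {s : ℕ} {k : ℕ} {L M : Module.End ℂ (Sym s)} (hL : Lowers k L)
    (hM : Lowers k M) : Lowers k (L + M) :=
  fun d f hf => (hL d f hf).add (hM d f hf)

theorem Lowers.smul {s : ℕ} {k : ℕ} {L : Module.End ℂ (Sym s)} (c : ℂ) (hL : Lowers k L) :
    Lowers k (c • L) :=
  fun d f hf => (hL d f hf).smul c

theorem Lowers.sum {s : ℕ} {k : ℕ} {ι : Type*} (S : Finset ι) (L : ι → Module.End ℂ (Sym s))
    (hL : ∀ i ∈ S, Lowers k (L i)) : Lowers k (∑ i ∈ S, L i) :=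
  Finset.sum_induction L (Lowers k) (fun _ _ => Lowers.add) (Lowers.zero k) hL

theorem Lowers.mul {s : ℕ} {k k' : ℕ} {L M : Module.End ℂ (Sym s)} (hL : Lowers k L)
    (hM : Lowers k' M) : Lowers (k + k') (L * M) := by
  intro d f hf
  have := hL _ _ (hM d f hf)
  rw [sub_sub, add_comm (k' : ℤ)] at this
  exact_mod_cast this

theorem lowers_pPerp {s : ℕ} (a : Fin s) (n : ℕ+) : Lowers (n : ℕ) (pPerp a n) := by
  refine Lowers.smul _ ?_
  intro d f hf m hm
  have h1 : MvPolynomial.coeff (m + Finsupp.single (a, n) 1) f ≠ 0 := by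
    intro h0
    apply hm
    change MvPolynomial.coeff m (MvPolynomial.pderiv (a, n) f) = 0
    rw [MvPolynomial.coeff_pderiv, h0, zero_mul]
  have h2 := hf _ h1
  rw [map_add, Finsupp.weight_single] at h2
  push_cast at h2
  simp only [smul_eq_mul, one_mul] at h2
  linarith

theorem lowers_expCoeff {s : ℕ} (x : ℕ+ → Module.End ℂ (Sym s))
    (hx : ∀ n : ℕ+, Lowers (n : ℕ) (x n)) (k : ℕ) : Lowers k (expCoeff x k) := by
  have hP : ∀ n, Lowers n (PowerSeries.coeff n (logSeries x)) := by
    intro n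
    rw [logSeries, PowerSeries.coeff_mk]
    split_ifs with hn
    · exact (hx ⟨n, hn⟩).smul _
    · exact Lowers.zero n
  have hpow : ∀ j n, Lowers n (PowerSeries.coeff n ((logSeries x) ^ j)) := by
    intro j
    induction j with
    | zero =>
      intro n
      rw [pow_zero, PowerSeries.coeff_one]
      split_ifs with hn
      · subst hn
        intro d f hf
        simpa using hf
      · exact Lowers.zero n
    | succ j ih =>
      intro n
      rw [pow_succ, PowerSeries.coeff_mul]
      refine Lowers.sum _ _ fun q hq => ?_
      rw [← Finset.HasAntidiagonal.mem_antidiagonal.mp hq]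
      exact (ih q.1).mul (hP q.2)
  exact Lowers.sum _ _ fun j _ => (hpow j k).smul _

theorem lowers_hPerp {s : ℕ} (a : Fin s) (k : ℕ) : Lowers k (hPerp a k) :=
  lowers_expCoeff _ (lowers_pPerp a) k

theorem lowers_ePerp {s : ℕ} (a : Fin s) (k : ℕ) : Lowers k (ePerp a k) :=
  lowers_expCoeff _ (fun n => (lowers_pPerp a n).smul _) k

theorem Lowers.eventually_zero {s : ℕ} {L : ℕ → Module.End ℂ (Sym s)}
    (hL : ∀ k, Lowers k (L k)) (f : Sym s) : ∃ N : ℕ, ∀ k, N ≤ k → L k f = 0 := by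
  obtain ⟨d, hd⟩ := DegLE.exists_bound f
  refine ⟨d + 1, fun k hk => DegLE.eq_zero ?_ (hL k d f hd)⟩
  omega

/-! ### Charged free fermions -/

/-- The sum of a family of linear maps which is finite on every vector. -/
def locFinSum {ι M N : Type*} [AddCommMonoid M] [Module ℂ M] [AddCommMonoid N] [Module ℂ N]
    (L : ι → M →ₗ[ℂ] N) (hL : ∀ x, (Function.support fun i => L i x).Finite) : M →ₗ[ℂ] N where
  toFun x := ∑ᶠ i, L i x
  map_add' x y := by
    simp only [map_add]
    exact finsum_add_distrib (hL x) (hL y)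
  map_smul' c x := by
    simp only [map_smul, RingHom.id_apply]
    exact (smul_finsum' c (hL x)).symm

theorem finite_plus {s : ℕ} (a : Fin s) (n : ℤ) (f : Sym s) :
    (Function.support fun k : ℕ =>
      ((-1 : ℂ) ^ k • (LinearMap.mulLeft ℂ (hInt a (n + k)) ∘ₗ ePerp a k)) f).Finite := by
  obtain ⟨N, hN⟩ := Lowers.eventually_zero (lowers_ePerp a) f
  refine (Set.finite_lt_nat N).subset fun k hk => ?_
  by_contra hlt
  exact hk (by simp [hN k (not_lt.mp hlt)])

theorem finite_minus {s : ℕ} (a : Fin s) (n : ℤ) (f : Sym s) :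
    (Function.support fun k : ℕ =>
      ((-1 : ℂ) ^ (n + k) • (LinearMap.mulLeft ℂ (eInt a (n + k)) ∘ₗ hPerp a k)) f).Finite := by
  obtain ⟨N, hN⟩ := Lowers.eventually_zero (lowers_hPerp a) f
  refine (Set.finite_lt_nat N).subset fun k hk => ?_
  by_contra hlt
  exact hk (by simp [hN k (not_lt.mp hlt)])

/-- The coefficient of `u^n` in `H⁽ᵃ⁾(u) E⁽ᵃ⁾^⊥(-u)`, i.e. `∑_k h_{n+k} (-1)^k e_k^⊥`. -/
def vertexPlus {s : ℕ} (a : Fin s) (n : ℤ) : Sym s →ₗ[ℂ] Sym s :=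
  locFinSum
    (fun k : ℕ => (-1 : ℂ) ^ k • (LinearMap.mulLeft ℂ (hInt a (n + k)) ∘ₗ ePerp a k))
    (finite_plus a n)

/-- The coefficient of `u^n` in `E⁽ᵃ⁾(-u) H⁽ᵃ⁾^⊥(u)`, i.e. `∑_k (-1)^{n+k} e_{n+k} h_k^⊥`. -/
def vertexMinus {s : ℕ} (a : Fin s) (n : ℤ) : Sym s →ₗ[ℂ] Sym s :=
  locFinSum
    (fun k : ℕ => (-1 : ℂ) ^ (n + k) • (LinearMap.mulLeft ℂ (eInt a (n + k)) ∘ₗ hPerp a k))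
    (finite_minus a n)

/-- The sign `(-1)^{m_1 + ⋯ + m_{a-1}}`. -/
def leftSign {s : ℕ} (a : Fin s) (m : Fin s → ℤ) : ℂ := (-1) ^ (∑ b ∈ Finset.Iio a, m b)

/-- The linear operator on the Fock space with `z^m f ↦ L m f`. -/
def fockLift {s : ℕ} (L : (Fin s → ℤ) → Sym s →ₗ[ℂ] Fock s) : Fock s →ₗ[ℂ] Fock s :=
  (Finsupp.lsum ℂ L) ∘ₗ (AddMonoidAlgebra.coeffLinearEquiv ℂ).toLinearMap

/-- The coefficient of `u^n` in `ψ⁺⁽ᵃ⁾(u) = R⁺⁽ᵃ⁾(u) H⁽ᵃ⁾(u) E⁽ᵃ⁾^⊥(-u)`, where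
`R⁺⁽ᵃ⁾(u) (z^m f) = (-1)^{m_1+⋯+m_{a-1}} z_a z^m u^{m_a} f`.
In the half-integer labelling `ψ(u) = ∑_{i ∈ ℤ+1/2} ψ_i u^{-i-1/2}` this is the mode
with `i = -n-1/2`. -/
def psiPlus {s : ℕ} (a : Fin s) (n : ℤ) : Fock s →ₗ[ℂ] Fock s :=
  fockLift fun m => leftSign a m •
    (AddMonoidAlgebra.lsingle (m + Pi.single a 1) ∘ₗ vertexPlus a (n - m a))

/-- The coefficient of `u^n` in `ψ⁻⁽ᵃ⁾(u) = R⁻⁽ᵃ⁾(u) E⁽ᵃ⁾(-u) H⁽ᵃ⁾^⊥(u)`, where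
`R⁻⁽ᵃ⁾(u) (z^m f) = (-1)^{m_1+⋯+m_{a-1}} z_a⁻¹ z^m u^{-m_a} f`;
again the mode `ψ_i` with `i = -n-1/2`. -/
def psiMinus {s : ℕ} (a : Fin s) (n : ℤ) : Fock s →ₗ[ℂ] Fock s :=
  fockLift fun m => leftSign a m •
    (AddMonoidAlgebra.lsingle (m - Pi.single a 1) ∘ₗ vertexMinus a (n + m a))

theorem vertexPlus_eventually_zero {s : ℕ} (a : Fin s) (f : Sym s) :
    ∃ N : ℤ, ∀ n, n ≤ N → vertexPlus a n f = 0 := by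
  obtain ⟨N, hN⟩ := Lowers.eventually_zero (lowers_ePerp a) f
  refine ⟨-N - 1, fun n hn => ?_⟩
  change ∑ᶠ k : ℕ, _ = _
  rw [finsum_congr (g := fun _ => 0) fun k => ?_, finsum_zero]
  rcases le_or_gt N k with hk | hk
  · simp [hN k hk]
  · have : ¬ (0 ≤ n + (k : ℤ)) := by omega
    simp [hInt, this]

theorem vertexMinus_eventually_zero {s : ℕ} (a : Fin s) (f : Sym s) :
    ∃ N : ℤ, ∀ n, n ≤ N → vertexMinus a n f = 0 := by
  obtain ⟨N, hN⟩ := Lowers.eventually_zero (lowers_hPerp a) f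
  refine ⟨-N - 1, fun n hn => ?_⟩
  change ∑ᶠ k : ℕ, _ = _
  rw [finsum_congr (g := fun _ => 0) fun k => ?_, finsum_zero]
  rcases le_or_gt N k with hk | hk
  · simp [hN k hk]
  · have : ¬ (0 ≤ n + (k : ℤ)) := by omega
    simp [eInt, this]

theorem fockLift_single {s : ℕ} (L : (Fin s → ℤ) → Sym s →ₗ[ℂ] Fock s) (m : Fin s → ℤ)
    (f : Sym s) : fockLift L (AddMonoidAlgebra.single m f) = L m f := by
  simp [fockLift]

theorem psiPlus_eventually_zero {s : ℕ} (a : Fin s) (x : Fock s) :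
    ∃ N : ℤ, ∀ n, n ≤ N → psiPlus a n x = 0 := by
  induction x using AddMonoidAlgebra.induction_linear with
  | zero => exact ⟨0, fun n _ => map_zero _⟩
  | add x y hx hy =>
    obtain ⟨N, hN⟩ := hx
    obtain ⟨M, hM⟩ := hy
    refine ⟨min N M, fun n hn => ?_⟩
    rw [map_add, hN n (hn.trans (min_le_left _ _)), hM n (hn.trans (min_le_right _ _)), add_zero]
  | single m f =>
    obtain ⟨N, hN⟩ := vertexPlus_eventually_zero a f
    refine ⟨N + m a, fun n hn => ?_⟩
    have := hN (n - m a) (by omega)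
    simp [psiPlus, fockLift_single, this]

theorem psiMinus_eventually_zero {s : ℕ} (a : Fin s) (x : Fock s) :
    ∃ N : ℤ, ∀ n, n ≤ N → psiMinus a n x = 0 := by
  induction x using AddMonoidAlgebra.induction_linear with
  | zero => exact ⟨0, fun n _ => map_zero _⟩
  | add x y hx hy =>
    obtain ⟨N, hN⟩ := hx
    obtain ⟨M, hM⟩ := hy
    refine ⟨min N M, fun n hn => ?_⟩
    rw [map_add, hN n (hn.trans (min_le_left _ _)), hM n (hn.trans (min_le_right _ _)), add_zero]
  | single m f =>
    obtain ⟨N, hN⟩ := vertexMinus_eventually_zero a f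
    refine ⟨N - m a, fun n hn => ?_⟩
    have := hN (n + m a) (by omega)
    simp [psiMinus, fockLift_single, this]

/-! ### The bilinear identity and tau-functions -/

theorem finite_omega {s : ℕ} (a : Fin s) (t : Fock s ⊗[ℂ] Fock s) :
    (Function.support fun n : ℤ =>
      TensorProduct.map (psiPlus a n) (psiMinus a (-n - 1)) t).Finite := by
  induction t using TensorProduct.induction_on with
  | zero => simp
  | tmul x y =>
    obtain ⟨N, hN⟩ := psiPlus_eventually_zero a x
    obtain ⟨M, hM⟩ := psiMinus_eventually_zero a y
    refine (Set.finite_Icc N (-M)).subset fun n hn => ?_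
    by_contra hout
    rw [Set.mem_Icc, not_and_or, not_le, not_le] at hout
    rcases hout with h1 | h1
    · exact hn (by simp [hN n h1.le])
    · exact hn (by simp [hM (-n - 1) (by omega)])
  | add x y hx hy =>
    refine (hx.union hy).subset fun n hn => ?_
    by_contra hout
    rw [Set.mem_union, not_or, Function.notMem_support, Function.notMem_support] at hout
    exact hn (by simp only [map_add, hout.1, hout.2, add_zero])

/-- `Ω = ∑_a ∑_{k ∈ ℤ+1/2} ψ⁺⁽ᵃ⁾_k ⊗ ψ⁻⁽ᵃ⁾_{-k}`; with `k = -n-1/2` the two modes are the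
coefficients of `u^n` in `ψ⁺⁽ᵃ⁾(u)` and of `u^{-n-1}` in `ψ⁻⁽ᵃ⁾(u)`. -/
def Omega (s : ℕ) : Fock s ⊗[ℂ] Fock s →ₗ[ℂ] Fock s ⊗[ℂ] Fock s :=
  ∑ a : Fin s, locFinSum
    (fun n : ℤ => TensorProduct.map (psiPlus a n) (psiMinus a (-n - 1))) (finite_omega a)

/-- `τ` lies in the subspace of charge `c`: only `z^m` with `m_1 + ⋯ + m_s = c` occur. -/
def HasCharge {s : ℕ} (c : ℤ) (τ : Fock s) : Prop :=
  ∀ m : Fin s → ℤ, τ.coeff m ≠ 0 → ∑ a, m a = c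

/-- `τ` is a tau-function of charge `c` of the `s`-component KP hierarchy: a non-zero solution
of charge `c` of the bilinear identity `Ω (τ ⊗ τ) = 0`. -/
def IsTauFunction {s : ℕ} (c : ℤ) (τ : Fock s) : Prop :=
  τ ≠ 0 ∧ HasCharge c τ ∧ Omega s (τ ⊗ₜ[ℂ] τ) = 0

/-! ### The generating functions -/

/-- Laurent series in `u_1, …, u_l` over `R`: Hahn series with exponents in `ℤ^l`. This ring
contains `R[[u_1, …, u_l]][u_1⁻¹, …, u_l⁻¹]`; `F.coeff α` is the coefficient of `u^α`. -/
abbrev MultiLaurent (l : ℕ) (R : Type) [Zero R] : Type := HahnSeries (Fin l → ℤ) R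

/-- The substitution `F(u) ↦ F(u_i)`. -/
def substVar {l : ℕ} {R : Type} [CommRing R] (i : Fin l) :
    LaurentSeries R →+* MultiLaurent l R :=
  HahnSeries.embDomainRingHom (AddMonoidHom.single (fun _ : Fin l => ℤ) i)
    (Pi.single_injective (M := fun _ : Fin l => ℤ) i) (fun _ _ => Pi.single_le_single)

/-- The monomial `u_i^n`, `n ∈ ℤ`. -/
def uPow {l : ℕ} {R : Type} [CommRing R] (i : Fin l) (n : ℤ) : MultiLaurent l R :=
  HahnSeries.single (Pi.single i n) 1

/-- `T_i⁽ʳ⁾(u) = A_i⁽ʳ⁾(u) H⁽ʳ⁾(u)`, with `A i r` standing for `A_i⁽ʳ⁾`. -/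
def Tone {s l : ℕ} (A : Fin l → Fin s → LaurentSeries ℂ) (i : Fin l) (r : Fin s) :
    LaurentSeries (Sym s) :=
  (A i r).map (algebraMap ℂ (Sym s)) * HahnSeries.ofPowerSeries ℤ (Sym s) (PowerSeries.mk (h r))

/-- `T^{(a_l,…,a_1)}(u_1,…,u_l) = ∏_{i<j} (u_j - u_i)^{δ_{a_i,a_j}} ∏_j T_j^{(a_j)}(u_j)`;
the function `a` is `i ↦ a_i`. -/
def Tcolour {s l : ℕ} (A : Fin l → Fin s → LaurentSeries ℂ) (a : Fin l → Fin s) :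
    MultiLaurent l (Sym s) :=
  (∏ i : Fin l, ∏ j ∈ Finset.Ioi i, if a i = a j then uPow j 1 - uPow i 1 else 1) *
    ∏ j : Fin l, substVar j (Tone A j (a j))

/-- `ε` on finite sequences: `ε(a) = 1` and
`ε(a, a_l, …, a_1) = (-1)^{#{i | a_i < a}} ε(a_l, …, a_1)`. -/
def eps {s : ℕ} : List (Fin s) → ℤ
  | [] => 1
  | a :: L => (-1) ^ (L.countP (fun b => decide (b < a))) * eps L

/-- `ε(a_l, …, a_1)` for a sequence given as `i ↦ a_i`. -/
def epsSeq {s l : ℕ} (a : Fin l → Fin s) : ℤ := eps (List.ofFn a).reverse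

/-- The variable `z_a`. -/
def z {s : ℕ} (a : Fin s) : Fock s := AddMonoidAlgebra.single (Pi.single a 1) 1

/-- `T(u_1,…,u_l) = ∑_{a_1,…,a_l=1}^s ε(a_l,…,a_1) z_{a_1} ⋯ z_{a_l} T^{(a_l,…,a_1)}(u_1,…,u_l)`. -/
def T {s l : ℕ} (A : Fin l → Fin s → LaurentSeries ℂ) : MultiLaurent l (Fock s) :=
  ∑ a : Fin l → Fin s,
    HahnSeries.C ((epsSeq a : Fock s) * ∏ i, z (a i)) *
      (Tcolour A a).map (algebraMap (Sym s) (Fock s))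

/-! ### The determinant -/

/-- The partial sum `m_1 + ⋯ + m_r`, for `r = 0, …, s`. -/
def partialSum {s : ℕ} (m : Fin s → ℕ) (r : ℕ) : ℕ :=
  ∑ a ∈ Finset.univ.filter (fun a : Fin s => (a : ℕ) < r), m a

/-- The values at integers of the piecewise linear function `σ_m` of slope one on `[0, l]`
with `σ_m(0) = 0`, whose only discontinuities are drops to `0` immediately to the right of
`m_1, m_1+m_2, …, m_1+⋯+m_{s-1}`: that is, `σ_m(x)` is the distance from `x` to the largest
partial sum `< x`. -/
def sigma {s : ℕ} (m : Fin s → ℕ) (x : ℕ) : ℕ :=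
  x - ((Finset.range s).filter (fun r => partialSum m r < x)).sup (partialSum m)

/-- The sequence `(a_1, …, a_l) = (1, …, 1, 2, …, 2, …, s, …, s)` in which `r` is repeated `m_r`
times, i.e. `(a_l, …, a_1) = (s, …, s, …, 1, …, 1)`. (The equivalence `finSigmaFinEquiv` cuts
`{1, …, m_1+⋯+m_s}` into consecutive blocks of lengths `m_1, …, m_s`.) -/
def colour {s l : ℕ} (m : Fin s → ℕ) (hm : ∑ r, m r = l) (j : Fin l) : Fin s :=
  (finSigmaFinEquiv.symm (Fin.cast hm.symm j)).1

/-- `T_m(u_1,…,u_l) = (-1)^{∑_{i<j} m_i m_j} det [u_i^{σ_m(j)-1} T_i^{(a_j)}(u_i)]_{i,j=1,…,l}`.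
Indices in `Fin l` start at `0`, so that the column `j : Fin l` is the `(j+1)`-st one. -/
def Tdet {s l : ℕ} (A : Fin l → Fin s → LaurentSeries ℂ) (m : Fin s → ℕ)
    (hm : ∑ r, m r = l) : MultiLaurent l (Sym s) :=
  (-1) ^ (∑ i : Fin s, ∑ j ∈ Finset.Ioi i, m i * m j) *
    Matrix.det (Matrix.of fun i j : Fin l =>
      uPow i ((sigma m ((j : ℕ) + 1) : ℤ) - 1) * substVar i (Tone A i (colour m hm j)))

end MultiKP

end

/-!
The series `T(u_1, …, u_l)` is a product of free fermions applied to the vacuum. Put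
`Ψ_i(u) = ∑_a A_i⁽ᵃ⁾(u) ψ⁺⁽ᵃ⁾(u)`. Since `ψ⁺⁽ᵃ⁾(u)` maps `H⁽ᵃ⁾(v) f` to
`(1 - v/u) H⁽ᵃ⁾(v) ψ⁺⁽ᵃ⁾(u) f` and passes through `H⁽ᵇ⁾(v)` for `b ≠ a`, while the operator
`R⁺⁽ᵃ⁾(u)` supplies the powers of `u` and the signs, one gets
`T(u_1, …, u_l) = Ψ_l(u_l) ⋯ Ψ_1(u_1) 1` (`list_prod_psiPlus_one`, `coeff_T_eq_list_prod`). Modes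
of `ψ⁺` with negative exponent do not contribute to the coefficient of `u^α`, so that this
coefficient is `Ψ_l ⋯ Ψ_1 1` for *finite* linear combinations `Ψ_i` of modes.

For such a combination `Ψ` the canonical anticommutation relations give `Ψ² = 0` and
`ψ⁻ Ψ = c - Ψ ψ⁻` with scalars `c`, and therefore `Ω (Ψ ⊗ Ψ) = (Ψ ⊗ Ψ) Ω - Ψ² ⊗ 1 = (Ψ ⊗ Ψ) Ω`
(`Omega_fermion_tmul`). As `Ω (1 ⊗ 1) = 0`, every vector `Ψ_l ⋯ Ψ_1 1` solves the bilinear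
identity.

The anticommutation relations are reduced to the vacuum. The only property of a vertex operator
`V(u)` that is extracted from its definition is its commutator with the power sums,
`[p_m, V_n] = ± V_{n+m}` for equal colours and `0` otherwise (`IsVertex`), together with the value
`V(u) 1`. The commutator of `p_m` with either side of a quadratic relation among the modes is a sum
of relations of the same kind, so that a relation holds as soon as it holds on `1`; there it is an
identity between the `h_k` and `e_k` that follows from Newton's identities.

For the determinant, expand it by multilinearity in the rows into a sum over all colourings
`a_1, …, a_l`. The summand is antisymmetric under permutations of the pairs `(a_i, u_i)`, and so is
`ε(a_l, …, a_1) ∏_{i<j} (u_j - u_i)^{δ_{a_i, a_j}}`, which is a product over `i < j` of expressions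
antisymmetric in `i` and `j` (`signedDiff`). It is thus enough to compare the two for the sorted
colouring, where the matrix is a block diagonal of Vandermonde matrices (`prod_signedDiff`).
-/

namespace MultiKP

open scoped TensorProduct

/-! ### Exponential series and Newton's identities -/

section Exponential

variable {R : Type*} [Ring R]

/-- The Euler operator `w d/dw`, over a ring that need not be commutative. -/
noncomputable def euler (f : PowerSeries R) : PowerSeries R :=
  PowerSeries.mk fun k => (k : R) * PowerSeries.coeff k f

theorem coeff_euler (f : PowerSeries R) (k : ℕ) :
    PowerSeries.coeff k (euler f) = (k : R) * PowerSeries.coeff k f :=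
  PowerSeries.coeff_mk _ _

theorem euler_mul (f g : PowerSeries R) : euler (f * g) = euler f * g + f * euler g := by
  ext k
  simp only [coeff_euler, PowerSeries.coeff_mul, map_add, Finset.mul_sum,
    ← Finset.sum_add_distrib]
  refine Finset.sum_congr rfl fun q hq => ?_
  rw [← Finset.HasAntidiagonal.mem_antidiagonal.mp hq, Nat.cast_add, add_mul, mul_assoc,
    ← mul_assoc _ (q.2 : R),
    ← (Nat.cast_commute q.2 (PowerSeries.coeff q.1 f)).eq, mul_assoc]

variable [Algebra ℂ R]

theorem coeff_euler_logSeries (x : ℕ+ → R) (k : ℕ) :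
    PowerSeries.coeff k (euler (logSeries x)) = if hk : 0 < k then x ⟨k, hk⟩ else 0 := by
  rw [coeff_euler, logSeries, PowerSeries.coeff_mk]
  split_ifs with hk
  · rw [mul_smul_comm, ← nsmul_eq_mul, ← Nat.cast_smul_eq_nsmul ℂ, smul_smul,
      inv_mul_cancel₀ (by exact_mod_cast hk.ne'), one_smul]
  · simp

theorem commute_euler_logSeries {x : ℕ+ → R} (hx : ∀ i j, Commute (x i) (x j)) :
    Commute (euler (logSeries x)) (logSeries x) := by
  refine PowerSeries.ext fun k => ?_
  rw [PowerSeries.coeff_mul, PowerSeries.coeff_mul, ← Finset.Nat.sum_antidiagonal_swap]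
  refine Finset.sum_congr rfl fun q _ => ?_
  simp only [Prod.fst_swap, Prod.snd_swap]
  rw [coeff_euler_logSeries, logSeries, PowerSeries.coeff_mk]
  split_ifs with h1 h2
  · rw [mul_smul_comm, smul_mul_assoc]
    exact congrArg _ (hx _ _).eq
  all_goals simp

theorem euler_logSeries_pow {x : ℕ+ → R} (hx : ∀ i j, Commute (x i) (x j)) (j : ℕ) :
    euler (logSeries x ^ (j + 1)) = (j + 1) • (euler (logSeries x) * logSeries x ^ j) := by
  induction j with
  | zero => simp
  | succ j ih =>
    rw [pow_succ, euler_mul, ih, ((commute_euler_logSeries hx).symm.pow_left (j + 1)).eq,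
      smul_mul_assoc, mul_assoc, ← pow_succ, ← succ_nsmul]

theorem coeff_logSeries_pow_of_lt (x : ℕ+ → R) {j k : ℕ} (hk : k < j) :
    PowerSeries.coeff k (logSeries x ^ j) = 0 := by
  induction j generalizing k with
  | zero => omega
  | succ j ih =>
    rw [pow_succ, PowerSeries.coeff_mul]
    refine Finset.sum_eq_zero fun q hq => ?_
    have hq' := Finset.HasAntidiagonal.mem_antidiagonal.mp hq
    rcases Nat.eq_zero_or_pos q.2 with h2 | h2
    · simp [h2, logSeries]
    · rw [ih (by omega), zero_mul]

theorem expCoeff_eq_sum_range (x : ℕ+ → R) {k K : ℕ} (hk : k < K) :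
    expCoeff x k = ∑ j ∈ Finset.range K,
      ((j.factorial : ℂ)⁻¹) • PowerSeries.coeff k (logSeries x ^ j) := by
  refine Finset.sum_subset (fun j hj => ?_) fun j _ hj => ?_
  · rw [Finset.mem_range] at hj ⊢
    omega
  · rw [coeff_logSeries_pow_of_lt x (by simpa using hj), smul_zero]

theorem expCoeff_zero (x : ℕ+ → R) : expCoeff x 0 = 1 := by
  simp [expCoeff]

/-- Newton's identities: `E = exp (∑ x_n w^n / n)` satisfies `w E' = (∑ x_n w^n) E`. -/
theorem newton {x : ℕ+ → R} (hx : ∀ i j, Commute (x i) (x j)) (k : ℕ) :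
    (k : ℂ) • expCoeff x k = ∑ q ∈ Finset.HasAntidiagonal.antidiagonal k,
      PowerSeries.coeff q.1 (euler (logSeries x)) * expCoeff x q.2 := by
  have key : ∀ j : ℕ, (k : ℂ) • (((j + 1).factorial : ℂ)⁻¹ •
      PowerSeries.coeff k (logSeries x ^ (j + 1))) = ((j.factorial : ℂ)⁻¹) •
        PowerSeries.coeff k (euler (logSeries x) * logSeries x ^ j) := by
    intro j
    rw [smul_comm, Nat.cast_smul_eq_nsmul, nsmul_eq_mul, ← coeff_euler, euler_logSeries_pow hx,
      map_nsmul, ← Nat.cast_smul_eq_nsmul ℂ, smul_smul, Nat.factorial_succ]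
    congr 1
    have h1 : ((j + 1 : ℕ) : ℂ) ≠ 0 := by exact_mod_cast Nat.succ_ne_zero j
    rw [Nat.cast_mul, mul_inv, mul_comm, ← mul_assoc, mul_inv_cancel₀ h1, one_mul]
  have h0 : (k : ℂ) • (((0 : ℕ).factorial : ℂ)⁻¹ •
      PowerSeries.coeff k (logSeries x ^ 0)) = 0 := by
    rcases Nat.eq_zero_or_pos k with rfl | hk
    · simp
    · simp [PowerSeries.coeff_one, hk.ne']
  rw [expCoeff, Finset.smul_sum, Finset.sum_range_succ', h0, add_zero,
    Finset.sum_congr rfl fun j _ => key j]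
  simp only [PowerSeries.coeff_mul, Finset.smul_sum]
  rw [Finset.sum_comm]
  refine Finset.sum_congr rfl fun q hq => ?_
  have hq' := Finset.HasAntidiagonal.mem_antidiagonal.mp hq
  rcases Nat.eq_zero_or_pos q.1 with h1 | h1
  · simp [h1, coeff_euler]
  · rw [expCoeff_eq_sum_range x (show q.2 < k by omega), Finset.mul_sum]
    simp only [mul_smul_comm]

theorem expCoeff_rescale (c : ℂ) (x : ℕ+ → R) (k : ℕ) :
    expCoeff (fun n : ℕ+ => c ^ (n : ℕ) • x n) k = c ^ k • expCoeff x k := by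
  have h : ∀ j k : ℕ, PowerSeries.coeff k (logSeries (fun n : ℕ+ => c ^ (n : ℕ) • x n) ^ j) =
      c ^ k • PowerSeries.coeff k (logSeries x ^ j) := by
    intro j
    induction j with
    | zero =>
      intro k
      rcases Nat.eq_zero_or_pos k with rfl | hk
      · simp
      · simp [PowerSeries.coeff_one, hk.ne']
    | succ j ih =>
      intro k
      rw [pow_succ, pow_succ, PowerSeries.coeff_mul, PowerSeries.coeff_mul, Finset.smul_sum]
      refine Finset.sum_congr rfl fun q hq => ?_
      rw [ih, ← Finset.HasAntidiagonal.mem_antidiagonal.mp hq, pow_add, mul_smul, smul_mul_assoc,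
        ← mul_smul_comm (c ^ q.2)]
      congr 2
      simp only [logSeries, PowerSeries.coeff_mk]
      split_ifs
      · rw [smul_comm]
        rfl
      · simp
  simp only [expCoeff, h, Finset.smul_sum]
  exact Finset.sum_congr rfl fun j _ => smul_comm _ _ _

/-- The coefficient of `w^k`, `k ∈ ℤ`, in `exp (∑ x_n w^n / n)`. -/
noncomputable def expInt (x : ℕ+ → R) (k : ℤ) : R := if 0 ≤ k then expCoeff x k.toNat else 0

theorem expInt_natCast (x : ℕ+ → R) (k : ℕ) : expInt x k = expCoeff x k := by simp [expInt]

theorem expInt_of_neg (x : ℕ+ → R) {k : ℤ} (hk : k < 0) : expInt x k = 0 := by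
  simp [expInt, not_le.mpr hk]

theorem expInt_zero (x : ℕ+ → R) : expInt x 0 = 1 := by simp [expInt, expCoeff_zero]

/-- Newton's identities with integer indices; the terms with `j ≥ k` vanish. -/
theorem newton_int {x : ℕ+ → R} (hx : ∀ i j, Commute (x i) (x j)) (k : ℤ) {K : ℕ}
    (hK : k ≤ K) :
    (k : ℂ) • expInt x k =
      ∑ j ∈ Finset.range K, x j.succPNat * expInt x (k - 1 - j) := by
  rcases lt_or_ge k 0 with hk | hk
  · rw [expInt_of_neg x hk, smul_zero]
    exact (Finset.sum_eq_zero fun j _ => by rw [expInt_of_neg x (by omega), mul_zero]).symm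
  · lift k to ℕ using hk
    rw [expInt_natCast, Int.cast_natCast, newton hx, Finset.Nat.sum_antidiagonal_eq_sum_range_succ
      (fun a b => PowerSeries.coeff a (euler (logSeries x)) * expCoeff x b),
      Finset.sum_range_succ', coeff_euler_logSeries]
    simp only [lt_irrefl, dite_false, zero_mul, add_zero]
    have hK' : k ≤ K := by exact_mod_cast hK
    rw [← Finset.sum_subset (Finset.range_subset_range.mpr hK')]
    · refine Finset.sum_congr rfl fun j hj => ?_
      rw [Finset.mem_range] at hj
      rw [coeff_euler_logSeries, dif_pos j.succ_pos,
        show (k : ℤ) - 1 - j = ((k - (j + 1) : ℕ) : ℤ) by omega, expInt_natCast]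
      rfl
    · intro j _ hj
      rw [Finset.mem_range, not_lt] at hj
      rw [expInt_of_neg x (by omega), mul_zero]

/-- The rule `[x_m, q] = c m`, `[x_j, q] = 0` for `j ≠ m`, exponentiated. -/
theorem expCoeff_mul_of_commutator {x : ℕ+ → R} (hx : ∀ i j, Commute (x i) (x j)) {q : R} {c : ℂ}
    {m : ℕ+} (hq : ∀ j, x j * q = q * x j + if j = m then (c * (m : ℕ)) • (1 : R) else 0)
    (k : ℕ) : expCoeff x k * q = q * expCoeff x k + c • expInt x ((k : ℤ) - (m : ℕ)) := by
  induction k using Nat.strong_induction_on with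
  | _ k ih =>
  rcases Nat.eq_zero_or_pos k with rfl | hk
  · have := m.pos
    rw [expCoeff_zero, expInt_of_neg x (by omega)]
    simp
  have ih' : ∀ j ∈ Finset.range k, x j.succPNat * expInt x (k - 1 - j) * q =
      q * (x j.succPNat * expInt x (k - 1 - j)) +
        ((if j.succPNat = m then (c * (m : ℕ)) • expInt x ((k : ℤ) - 1 - j) else 0) +
        c • (x j.succPNat * expInt x ((k : ℤ) - (m : ℕ) - 1 - j))) := by
    intro j hj
    rw [Finset.mem_range] at hj
    rw [show (k : ℤ) - 1 - j = ((k - 1 - j : ℕ) : ℤ) by omega, expInt_natCast, mul_assoc,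
      ih _ (by omega), show ((k - 1 - j : ℕ) : ℤ) - (m : ℕ) = k - (m : ℕ) - 1 - j by omega,
      mul_add, ← mul_assoc, hq, mul_smul_comm, add_mul, mul_assoc, add_assoc]
    split_ifs <;> simp
  have hsum : ∑ j ∈ Finset.range k,
      (if j.succPNat = m then (c * (m : ℕ)) • expInt x ((k : ℤ) - 1 - j) else 0) =
      (c * (m : ℕ)) • expInt x ((k : ℤ) - (m : ℕ)) := by
    have hm : (((m : ℕ) - 1 : ℕ)).succPNat = m := by
      apply PNat.eq
      simpa using Nat.succ_pred_eq_of_pos m.pos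
    have hiff : ∀ j : ℕ, j.succPNat = m ↔ j = (m : ℕ) - 1 := by
      intro j
      constructor
      · rintro rfl
        simp
      · rintro rfl
        exact hm
    simp only [hiff, Finset.sum_ite_eq', Finset.mem_range]
    have := m.pos
    split_ifs with h1
    · rw [show (k : ℤ) - 1 - ((m : ℕ) - 1 : ℕ) = k - (m : ℕ) by omega]
    · rw [expInt_of_neg x (by omega), smul_zero]
  have hk0 : (k : ℂ) ≠ 0 := by exact_mod_cast hk.ne'
  apply smul_right_injective R hk0
  change (k : ℂ) • (expCoeff x k * q) = (k : ℂ) • (q * expCoeff x k + _)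
  have hn := newton_int hx k le_rfl
  rw [expInt_natCast, Int.cast_natCast] at hn
  have hn' := newton_int hx ((k : ℤ) - (m : ℕ)) (K := k) (by omega)
  rw [← smul_mul_assoc, hn, Finset.sum_mul, Finset.sum_congr rfl ih', Finset.sum_add_distrib,
    Finset.sum_add_distrib, ← Finset.mul_sum, ← Finset.smul_sum, ← hn, ← hn', hsum, smul_add,
    mul_smul_comm]
  congr 1
  rw [smul_smul, smul_smul, ← add_smul]
  congr 1
  push_cast
  ring

end Exponential

/-- `exp L * exp (-L) = 1`: the Euler operator annihilates the product, which is therefore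
constant. -/
theorem sum_expInt_mul_expInt_neg {R : Type*} [CommRing R] [Algebra ℂ R] (x : ℕ+ → R) (N : ℕ) :
    ∑ i ∈ Finset.range (N + 1), expInt x ((N : ℤ) - i) * expInt (-x) i =
      if N = 0 then 1 else 0 := by
  have hE : ∀ y : ℕ+ → R, euler (PowerSeries.mk (expCoeff y)) =
      euler (logSeries y) * PowerSeries.mk (expCoeff y) := by
    intro y
    ext k
    rw [coeff_euler, PowerSeries.coeff_mk, PowerSeries.coeff_mul, ← nsmul_eq_mul,
      ← Nat.cast_smul_eq_nsmul ℂ, newton fun i j => Commute.all _ _]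
    simp only [PowerSeries.coeff_mk]
  have hneg : euler (logSeries (-x)) = -euler (logSeries x) := by
    ext k
    rw [map_neg, coeff_euler_logSeries, coeff_euler_logSeries]
    split_ifs
    · rfl
    · simp
  have h0 : euler (PowerSeries.mk (expCoeff x) * PowerSeries.mk (expCoeff (-x))) = 0 := by
    rw [euler_mul, hE, hE, hneg]
    ring
  have hN : ∑ i ∈ Finset.range (N + 1), expInt x ((N : ℤ) - i) * expInt (-x) i =
      PowerSeries.coeff N (PowerSeries.mk (expCoeff x) * PowerSeries.mk (expCoeff (-x))) := by
    rw [mul_comm, PowerSeries.coeff_mul, Finset.Nat.sum_antidiagonal_eq_sum_range_succ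
      (fun a b => PowerSeries.coeff a (PowerSeries.mk (expCoeff (-x))) *
        PowerSeries.coeff b (PowerSeries.mk (expCoeff x)))]
    refine Finset.sum_congr rfl fun i hi => ?_
    rw [Finset.mem_range] at hi
    rw [show (N : ℤ) - i = ((N - i : ℕ) : ℤ) by omega, expInt_natCast, expInt_natCast,
      PowerSeries.coeff_mk, PowerSeries.coeff_mk, mul_comm]
  split_ifs with h
  · subst h
    simp [expInt_zero]
  · have h1 := congrArg (PowerSeries.coeff N) h0
    rw [coeff_euler, ← hN, map_zero, ← nsmul_eq_mul, ← Nat.cast_smul_eq_nsmul ℂ] at h1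
    exact (smul_eq_zero.mp h1).resolve_left (by exact_mod_cast h)

/-! ### Vertex operators on symmetric functions -/

theorem pPerp_commute {s : ℕ} (a b : Fin s) (i j : ℕ+) : Commute (pPerp a i) (pPerp b j) := by
  have h0 : ⁅MvPolynomial.pderiv (R := ℂ) (a, i), MvPolynomial.pderiv (R := ℂ) (b, j)⁆ = 0 := by
    refine MvPolynomial.derivation_ext fun v => ?_
    simp [Derivation.commutator_apply, MvPolynomial.pderiv_X, Pi.single_apply, apply_ite]
  refine (Commute.smul_right ?_ _).smul_left _
  refine LinearMap.ext fun f => ?_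
  have h1 := congrArg (fun D => D f) h0
  rw [Derivation.commutator_apply] at h1
  exact sub_eq_zero.mp h1

theorem pPerp_mul_mulLeft {s : ℕ} (a b : Fin s) (j m : ℕ+) :
    pPerp a j * LinearMap.mulLeft ℂ (p b m) = LinearMap.mulLeft ℂ (p b m) * pPerp a j +
      if b = a ∧ j = m then ((m : ℕ) : ℂ) • (1 : Module.End ℂ (Sym s)) else 0 := by
  refine LinearMap.ext fun f => ?_
  simp only [pPerp, p, Module.End.mul_apply, LinearMap.add_apply, LinearMap.smul_apply,
    LinearMap.mulLeft_apply, Derivation.coeFn_coe, MvPolynomial.pderiv_mul, MvPolynomial.pderiv_X,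
    Pi.single_apply, Prod.mk.injEq]
  by_cases h : b = a ∧ j = m
  · rw [if_pos h, if_pos ⟨h.1, h.2.symm⟩, h.2, one_mul, smul_add, add_comm, mul_smul_comm]
    rfl
  · rw [if_neg h, if_neg fun h' => h ⟨h'.1, h'.2.symm⟩, zero_mul, zero_add, mul_smul_comm]
    simp

/-- The family `V n` consists of the modes of an operator `V(u) = ∑ V_n u^n` with the same
commutators with the power sums as the exponential of `-c ∑ u^{-n} ∂/∂p_n⁽ᵃ⁾`. -/
def IsVertex {s : ℕ} (c : ℂ) (a : Fin s) (V : ℤ → Sym s →ₗ[ℂ] Sym s) : Prop :=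
  ∀ (n : ℤ) (b : Fin s) (m : ℕ+) (f : Sym s),
    V n (p b m * f) = p b m * V n f - if b = a then c • V (n + (m : ℕ)) f else 0

section Modes

variable {s : ℕ}

theorem expCoeff_pPerp_mul (σ : ℂ) (a b : Fin s) (m : ℕ+) (k : ℕ) (f : Sym s) :
    expCoeff ((-σ) • pPerp a) k (p b m * f) = p b m * expCoeff ((-σ) • pPerp a) k f +
      (if b = a then -σ else 0) • expInt ((-σ) • pPerp a) ((k : ℤ) - (m : ℕ)) f := by
  have h := expCoeff_mul_of_commutator (x := (-σ) • pPerp a)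
    (fun i j => by
      simp only [Pi.smul_apply]
      exact ((pPerp_commute a a i j).smul_right _).smul_left _)
    (q := LinearMap.mulLeft ℂ (p b m)) (c := if b = a then -σ else 0) (m := m) ?_ k
  · exact congrArg (fun L : Module.End ℂ (Sym s) => L f) h
  · intro j
    rw [Pi.smul_apply, smul_mul_assoc, pPerp_mul_mulLeft, smul_add, mul_smul_comm]
    by_cases h1 : b = a <;> by_cases h2 : j = m <;> simp [h1, h2, smul_smul]
    all_goals exact (neg_smul _ _).symm

theorem lowers_expCoeff_smul (σ : ℂ) (a : Fin s) (k : ℕ) :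
    Lowers k (expCoeff (σ • pPerp a) k) :=
  lowers_expCoeff _ (fun n => (lowers_pPerp a n).smul _) k

/-- The operator `exp (σ ∑ p_n u^n / n) exp (-σ ∑ u^{-n} ∂/∂p_n)` has the commutators required by
`IsVertex`. -/
theorem isVertex_of_eq_finsum {σ : ℂ} {a : Fin s} {V : ℤ → Sym s →ₗ[ℂ] Sym s}
    (hV : ∀ n f, V n f =
      ∑ᶠ k : ℕ, expInt (σ • p a) (n + k) * expCoeff ((-σ) • pPerp a) k f) :
    IsVertex σ a V := by
  -- The sum may be cut off at any `K` beyond which the differential operators kill `f`.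
  have hfin : ∀ n f K, (∀ k, K ≤ k → expCoeff ((-σ) • pPerp a) k f = 0) → V n f =
      ∑ k ∈ Finset.range K, expInt (σ • p a) (n + k) * expCoeff ((-σ) • pPerp a) k f := by
    intro n f K hK
    rw [hV]
    refine finsum_eq_sum_of_support_subset _ fun k hk => ?_
    rw [Finset.mem_coe, Finset.mem_range]
    by_contra hlt
    exact hk (by simp only [hK k (not_lt.mp hlt), mul_zero])
  intro n b m f
  obtain ⟨K, hK⟩ := Lowers.eventually_zero (lowers_expCoeff_smul (-σ) a) f
  have hK' : ∀ k, (m : ℕ) + K ≤ k → expCoeff ((-σ) • pPerp a) k (p b m * f) = 0 := by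
    intro k hk
    rw [expCoeff_pPerp_mul, hK k (by omega),
      show (k : ℤ) - (m : ℕ) = ((k - m : ℕ) : ℤ) by omega, expInt_natCast, hK _ (by omega)]
    simp
  have hshift : ∑ k ∈ Finset.range ((m : ℕ) + K), expInt (σ • p a) (n + k) *
      expInt ((-σ) • pPerp a) ((k : ℤ) - (m : ℕ)) f = V (n + (m : ℕ)) f := by
    rw [Finset.sum_range_add, Finset.sum_eq_zero, zero_add, hfin _ _ K hK]
    · refine Finset.sum_congr rfl fun k _ => ?_
      rw [show (((m : ℕ) + k : ℕ) : ℤ) - (m : ℕ) = (k : ℤ) by omega, expInt_natCast]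
      congr 2
      push_cast
      ring
    · intro k hk
      rw [Finset.mem_range] at hk
      rw [expInt_of_neg ((-σ) • pPerp a) (by omega), LinearMap.zero_apply, mul_zero]
  rw [hfin n _ _ hK', hfin n f ((m : ℕ) + K) fun k hk => hK k (by omega), ← hshift]
  simp only [expCoeff_pPerp_mul]
  split_ifs
  · rw [Finset.mul_sum, Finset.smul_sum, ← Finset.sum_sub_distrib]
    refine Finset.sum_congr rfl fun k _ => ?_
    rw [mul_add, mul_smul_comm, neg_smul, ← sub_eq_add_neg, mul_left_comm]
  · rw [Finset.mul_sum, sub_zero]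
    refine Finset.sum_congr rfl fun k _ => ?_
    rw [zero_smul, add_zero, mul_left_comm]

theorem expCoeff_pPerp_one (σ : ℂ) (a : Fin s) {k : ℕ} (hk : 0 < k) :
    expCoeff (σ • pPerp a) k (1 : Sym s) = 0 := by
  refine DegLE.eq_zero (d := 0 - (k : ℤ)) (by omega) (lowers_expCoeff_smul σ a k 0 1 ?_)
  intro m hm
  rw [MvPolynomial.coeff_one] at hm
  have : m = 0 := by
    by_contra h0
    exact hm (if_neg fun h => h0 h.symm)
  simp [this]

theorem vertex_one_of_eq_finsum {σ : ℂ} {a : Fin s} {V : ℤ → Sym s →ₗ[ℂ] Sym s}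
    (hV : ∀ n f, V n f =
      ∑ᶠ k : ℕ, expInt (σ • p a) (n + k) * expCoeff ((-σ) • pPerp a) k f) (n : ℤ) :
    V n 1 = expInt (σ • p a) n := by
  rw [hV, finsum_eq_single _ 0]
  · simp [expCoeff_zero]
  · intro k hk
    rw [expCoeff_pPerp_one _ a (Nat.pos_of_ne_zero hk), mul_zero]

theorem expCoeff_sign {R : Type*} [Ring R] [Algebra ℂ R] (x : ℕ+ → R) (k : ℕ) :
    expCoeff (fun n : ℕ+ => (-1 : ℂ) ^ ((n : ℕ) + 1) • x n) k =
      (-1 : ℂ) ^ k • expCoeff ((-1 : ℂ) • x) k := by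
  rw [← expCoeff_rescale]
  congr 1
  funext n
  rw [Pi.smul_apply, smul_smul, pow_succ]

theorem hInt_eq (a : Fin s) (k : ℤ) : hInt a k = expInt ((1 : ℂ) • p a) k := by
  rw [one_smul]
  rfl

theorem eInt_eq (a : Fin s) (k : ℤ) : (-1 : ℂ) ^ k • eInt a k = expInt ((-1 : ℂ) • p a) k := by
  rw [eInt, expInt]
  split_ifs with hk
  · lift k to ℕ using hk
    rw [zpow_natCast, Int.toNat_natCast, e, expCoeff_sign, smul_smul, ← mul_pow]
    simp
  · exact smul_zero _

theorem vertexPlus_eq_finsum (a : Fin s) (n : ℤ) (f : Sym s) : vertexPlus a n f =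
    ∑ᶠ k : ℕ, expInt ((1 : ℂ) • p a) (n + k) * expCoeff ((-1 : ℂ) • pPerp a) k f := by
  refine finsum_congr fun k => ?_
  change ((-1 : ℂ) ^ k • (LinearMap.mulLeft ℂ (hInt a (n + k)) ∘ₗ ePerp a k)) f = _
  rw [show ePerp a k = _ from expCoeff_sign _ k, ← hInt_eq, LinearMap.smul_apply,
    LinearMap.comp_apply,
    LinearMap.smul_apply, map_smul, smul_smul, ← mul_pow]
  simp

theorem vertexMinus_eq_finsum (a : Fin s) (n : ℤ) (f : Sym s) : vertexMinus a n f =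
    ∑ᶠ k : ℕ, expInt ((-1 : ℂ) • p a) (n + k) * expCoeff ((- -1 : ℂ) • pPerp a) k f := by
  refine finsum_congr fun k => ?_
  rw [← eInt_eq, neg_neg, one_smul, LinearMap.smul_apply, LinearMap.comp_apply, smul_mul_assoc]
  rfl

theorem isVertex_vertexPlus (a : Fin s) : IsVertex 1 a (vertexPlus a) :=
  isVertex_of_eq_finsum (vertexPlus_eq_finsum a)

theorem isVertex_vertexMinus (a : Fin s) : IsVertex (-1) a (vertexMinus a) :=
  isVertex_of_eq_finsum (vertexMinus_eq_finsum a)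

theorem vertexPlus_one (a : Fin s) (n : ℤ) : vertexPlus a n 1 = expInt ((1 : ℂ) • p a) n :=
  vertex_one_of_eq_finsum (vertexPlus_eq_finsum a) n

theorem vertexMinus_one (a : Fin s) (n : ℤ) : vertexMinus a n 1 = expInt ((-1 : ℂ) • p a) n :=
  vertex_one_of_eq_finsum (vertexMinus_eq_finsum a) n

theorem newton_smul_p (d : ℂ) (a : Fin s) {k : ℤ} {K : ℕ} (hK : k ≤ K) :
    (k : ℂ) • expInt (d • p a) k = ∑ j ∈ Finset.range K,
      d • (p a j.succPNat * expInt (d • p a) (k - 1 - j)) := by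
  rw [newton_int (x := d • p a) (fun i j => Commute.all _ _) k hK]
  refine Finset.sum_congr rfl fun j _ => ?_
  rw [Pi.smul_apply, smul_mul_assoc]

/-- `V(u) (H(v) f) = (1 - v/u) H(v) V(u) f`, in coefficients. By Newton's identities
`k h_k = ∑ p_j h_{k-j}` this follows from the commutators of `V` with the `p_j`, by induction
on `k`. -/
theorem IsVertex.apply_expInt_mul {c d : ℂ} (hcd : c * d = 1) {a : Fin s}
    {V : ℤ → Sym s →ₗ[ℂ] Sym s} (hV : IsVertex c a V) (n k : ℤ) (f : Sym s) :
    V n (expInt (d • p a) k * f) =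
      expInt (d • p a) k * V n f - expInt (d • p a) (k - 1) * V (n + 1) f := by
  rcases lt_or_ge k 0 with hk | hk
  · simp [expInt_of_neg _ hk, expInt_of_neg _ (show k - 1 < 0 by omega)]
  lift k to ℕ using hk
  induction k using Nat.strong_induction_on generalizing n with
  | _ k ih =>
  rcases Nat.eq_zero_or_pos k with rfl | hk
  · simp [expInt_zero, expInt_of_neg]
  set g : ℤ → Sym s := expInt (d • p a) with hg
  have hg0 : ∀ i : ℤ, i < 0 → g i = 0 := fun i hi => expInt_of_neg _ hi
  have ih' : ∀ i n : ℤ, i < k → V n (g i * f) = g i * V n f - g (i - 1) * V (n + 1) f := by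
    intro i n hi
    rcases lt_or_ge i 0 with h0 | h0
    · simp [hg0 i h0, hg0 (i - 1) (by omega)]
    · lift i to ℕ using h0
      exact ih i (by omega) n
  -- The contributions of the commutators telescope in the sum over `j`.
  have hterm : ∀ j ∈ Finset.range k, V n (d • (p a j.succPNat * g (k - 1 - j)) * f) =
      d • (p a j.succPNat * g (k - 1 - j)) * V n f
        - d • (p a j.succPNat * g ((k - 1 : ℤ) - 1 - j)) * V (n + 1) f
        - (g (k - 1 - j) * V (n + 1 + j) f
          - g (k - 1 - (j + 1 : ℕ)) * V (n + 1 + (j + 1 : ℕ)) f) := by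
    intro j _
    rw [smul_mul_assoc, mul_assoc, map_smul, hV, if_pos rfl, smul_sub, smul_smul, mul_comm d c,
      hcd, one_smul, ih' _ _ (by omega), ih' _ _ (by omega), Nat.succPNat_coe]
    have e1 : n + ((j.succ : ℕ) : ℤ) = n + 1 + j := by push_cast; ring
    have e2 : n + ((j.succ : ℕ) : ℤ) + 1 = n + 1 + (j + 1 : ℕ) := by push_cast; ring
    have e3 : (k : ℤ) - 1 - j - 1 = (k - 1 : ℤ) - 1 - j := by ring
    have e4 : (k : ℤ) - 1 - (j + 1 : ℕ) = (k - 1 : ℤ) - 1 - j := by push_cast; ring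
    rw [e2, e1, e3, e4]
    simp only [Algebra.smul_def]
    ring
  have hk0 : (k : ℂ) ≠ 0 := by exact_mod_cast hk.ne'
  apply smul_right_injective _ hk0
  change (k : ℂ) • V n (g k * f) = (k : ℂ) • (_ - _)
  have hn := newton_smul_p d a (k := (k : ℤ)) le_rfl
  have hn' := newton_smul_p d a (k := (k : ℤ) - 1) (K := k) (by omega)
  rw [← hg, Int.cast_natCast] at hn
  rw [← hg] at hn'
  rw [← map_smul, ← smul_mul_assoc, hn, Finset.sum_mul, map_sum, Finset.sum_congr rfl hterm,
    Finset.sum_sub_distrib, Finset.sum_sub_distrib, ← Finset.sum_mul, ← Finset.sum_mul, ← hn,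
    ← hn', Finset.sum_range_sub', hg0 (k - 1 - k) (by omega)]
  simp only [Algebra.smul_def]
  push_cast
  simp only [sub_zero, add_zero]
  ring

/-- `V(u) (E(v) f) = (1 - v/u)⁻¹ E(v) V(u) f`, in coefficients and cleared of the inverse. -/
theorem IsVertex.apply_expInt_mul_of_neg {c d : ℂ} (hcd : c * d = -1) {a : Fin s}
    {V : ℤ → Sym s →ₗ[ℂ] Sym s} (hV : IsVertex c a V) (n k : ℤ) (f : Sym s) :
    V n (expInt (d • p a) k * f) =
      expInt (d • p a) k * V n f + V (n + 1) (expInt (d • p a) (k - 1) * f) := by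
  rcases lt_or_ge k 0 with hk | hk
  · simp [expInt_of_neg _ hk, expInt_of_neg _ (show k - 1 < 0 by omega)]
  lift k to ℕ using hk
  induction k using Nat.strong_induction_on generalizing n with
  | _ k ih =>
  rcases Nat.eq_zero_or_pos k with rfl | hk
  · simp [expInt_zero, expInt_of_neg]
  set g : ℤ → Sym s := expInt (d • p a) with hg
  have hg0 : ∀ i : ℤ, i < 0 → g i = 0 := fun i hi => expInt_of_neg _ hi
  have ih' : ∀ i n : ℤ, i < k → V n (g i * f) = g i * V n f + V (n + 1) (g (i - 1) * f) := by
    intro i n hi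
    rcases lt_or_ge i 0 with h0 | h0
    · simp [hg0 i h0, hg0 (i - 1) (by omega)]
    · lift i to ℕ using h0
      exact ih i (by omega) n
  -- The contributions of the commutators telescope in the sum over `j`.
  have hterm : ∀ j ∈ Finset.range k, V n (d • (p a j.succPNat * g (k - 1 - j)) * f) =
      d • (p a j.succPNat * g (k - 1 - j)) * V n f
        + V (n + 1) (d • (p a j.succPNat * g ((k - 1 : ℤ) - 1 - j)) * f)
        + (V (n + 1 + j) (g (k - 1 - j) * f)
          - V (n + 1 + (j + 1 : ℕ)) (g (k - 1 - (j + 1 : ℕ)) * f)) := by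
    intro j _
    rw [smul_mul_assoc, mul_assoc, map_smul, hV, if_pos rfl, smul_sub, smul_smul, mul_comm d c,
      hcd, ih' _ n (by omega), smul_mul_assoc, mul_assoc, smul_mul_assoc, mul_assoc,
      (V (n + 1)).map_smul, hV, if_pos rfl, smul_sub, smul_smul, mul_comm d c, hcd,
      Nat.succPNat_coe]
    have e1 : n + ((j.succ : ℕ) : ℤ) = n + 1 + j := by push_cast; ring
    have e2 : n + 1 + ((j.succ : ℕ) : ℤ) = n + 1 + (j + 1 : ℕ) := by push_cast; ring
    have e3 : (k : ℤ) - 1 - j - 1 = (k - 1 : ℤ) - 1 - j := by ring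
    have e4 : (k : ℤ) - 1 - (j + 1 : ℕ) = (k - 1 : ℤ) - 1 - j := by push_cast; ring
    rw [e2, e1, e3, e4]
    simp only [Algebra.smul_def, map_neg, map_one]
    ring
  have hk0 : (k : ℂ) ≠ 0 := by exact_mod_cast hk.ne'
  apply smul_right_injective _ hk0
  change (k : ℂ) • V n (g k * f) = (k : ℂ) • (_ + _)
  have hn := newton_smul_p d a (k := (k : ℤ)) le_rfl
  have hn' := newton_smul_p d a (k := (k : ℤ) - 1) (K := k) (by omega)
  rw [← hg, Int.cast_natCast] at hn
  rw [← hg] at hn'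
  rw [← map_smul, ← smul_mul_assoc, hn, Finset.sum_mul, map_sum, Finset.sum_congr rfl hterm,
    Finset.sum_add_distrib, Finset.sum_add_distrib, ← Finset.sum_mul, ← map_sum, ← Finset.sum_mul,
    ← hn, ← hn', Finset.sum_range_sub' fun j : ℕ => V (n + 1 + j) (g (k - 1 - j) * f),
    hg0 (k - 1 - k) (by omega), smul_mul_assoc, smul_mul_assoc,
    (V (n + 1)).map_smul, zero_mul, map_zero]
  push_cast
  simp only [sub_zero, add_zero, smul_add, sub_smul, one_smul]
  abel

theorem IsVertex.apply_expInt_mul_of_ne {c : ℂ} (d : ℂ) {a b : Fin s} (hab : b ≠ a)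
    {V : ℤ → Sym s →ₗ[ℂ] Sym s} (hV : IsVertex c a V) (n k : ℤ) (f : Sym s) :
    V n (expInt (d • p b) k * f) = expInt (d • p b) k * V n f := by
  rcases lt_or_ge k 0 with hk | hk
  · simp [expInt_of_neg _ hk]
  lift k to ℕ using hk
  induction k using Nat.strong_induction_on with
  | _ k ih =>
  rcases Nat.eq_zero_or_pos k with rfl | hk
  · simp [expInt_zero]
  have hk0 : (k : ℂ) ≠ 0 := by exact_mod_cast hk.ne'
  apply smul_right_injective _ hk0
  change (k : ℂ) • V n (expInt (d • p b) k * f) = (k : ℂ) • _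
  have hn := newton_smul_p d b (k := (k : ℤ)) le_rfl
  rw [Int.cast_natCast] at hn
  rw [← map_smul, ← smul_mul_assoc, ← smul_mul_assoc, hn, Finset.sum_mul, Finset.sum_mul, map_sum]
  refine Finset.sum_congr rfl fun j hj => ?_
  rw [Finset.mem_range] at hj
  rw [smul_mul_assoc, mul_assoc, map_smul, hV, if_neg hab, sub_zero,
    show (k : ℤ) - 1 - j = ((k - 1 - j : ℕ) : ℤ) by omega, ih _ (by omega), smul_mul_assoc,
    mul_assoc]

end Modes

/-! ### Canonical anticommutation relations -/

section Relations

variable {s : ℕ}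

/-- A statement about symmetric functions that is linear holds if it holds for `1` and is inherited
by products with power sums. -/
theorem Sym.induction_p {P : Sym s → Prop} (h0 : ∀ c : ℂ, P (c • (1 : Sym s)))
    (hadd : ∀ f g, P f → P g → P (f + g)) (hp : ∀ b m f, P f → P (p b m * f)) (f : Sym s) :
    P f := by
  induction f using MvPolynomial.induction_on with
  | C c =>
    have := h0 c
    rwa [MvPolynomial.smul_eq_C_mul, mul_one] at this
  | add f g hf hg => exact hadd f g hf hg
  | mul_X f v hf =>
    have := hp v.1 v.2 f hf
    rwa [mul_comm, p] at this

/-- The anticommutator of the modes of one colour; the shifts by `1` come from the charge. -/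
theorem IsVertex.anticomm {c d : ℂ} (hcd : c * d = 1) {a : Fin s} {V : ℤ → Sym s →ₗ[ℂ] Sym s}
    (hV : IsVertex c a V) (hV1 : ∀ n, V n 1 = expInt (d • p a) n) (n k : ℤ) (f : Sym s) :
    V (n - 1) (V k f) + V (k - 1) (V n f) = 0 := by
  induction f using Sym.induction_p generalizing n k with
  | h0 c' =>
    have h1 : ∀ i j, V i (V j 1) = expInt (d • p a) j * expInt (d • p a) i -
        expInt (d • p a) (j - 1) * expInt (d • p a) (i + 1) := by
      intro i j
      rw [hV1, ← mul_one (expInt (d • p a) j), hV.apply_expInt_mul hcd, hV1, hV1, mul_one]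
    simp only [map_smul, h1, sub_add_cancel]
    rw [← smul_add]
    convert smul_zero c' using 2
    ring
  | hadd f g hf hg =>
    simp only [map_add]
    rw [add_add_add_comm, hf, hg, add_zero]
  | hp b m f ih =>
    simp only [hV _ b]
    split_ifs with hb
    · simp only [map_sub, map_smul, hV _ b, if_pos hb]
      have e1 := ih (n + (m : ℕ)) k
      have e2 := ih n (k + (m : ℕ))
      rw [show n + ((m : ℕ) : ℤ) - 1 = n - 1 + (m : ℕ) by ring] at e1
      rw [show k + ((m : ℕ) : ℤ) - 1 = k - 1 + (m : ℕ) by ring] at e2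
      simp only [Algebra.smul_def]
      linear_combination p b m * ih n k - algebraMap ℂ (Sym s) c * e1 -
        algebraMap ℂ (Sym s) c * e2
    · simp only [sub_zero, hV _ b, if_neg hb]
      linear_combination p b m * ih n k

theorem IsVertex.comm_of_ne {c c' d d' : ℂ} {a b : Fin s} (hab : a ≠ b)
    {V W : ℤ → Sym s →ₗ[ℂ] Sym s} (hV : IsVertex c a V) (hW : IsVertex c' b W)
    (hV1 : ∀ n, V n 1 = expInt (d • p a) n) (hW1 : ∀ n, W n 1 = expInt (d' • p b) n)
    (n k : ℤ) (f : Sym s) : V n (W k f) = W k (V n f) := by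
  induction f using Sym.induction_p generalizing n k with
  | h0 z =>
    simp only [map_smul]
    rw [hV1, hW1, ← mul_one (expInt (d' • p b) k), ← mul_one (expInt (d • p a) n),
      hV.apply_expInt_mul_of_ne _ hab.symm, hW.apply_expInt_mul_of_ne _ hab, hV1, hW1, mul_comm]
  | hadd f g hf hg => simp only [map_add, hf, hg]
  | hp r m f ih =>
    simp only [hV _ r, hW _ r, map_sub]
    by_cases h1 : r = a
    · have h2 : r ≠ b := h1 ▸ hab
      simp only [if_pos h1, if_neg h2, sub_zero, map_zero, map_smul, ih]
    · simp only [if_neg h1, sub_zero, ih]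
      split_ifs <;> simp [ih]

/-- `E(-u) H^⊥(u) H(v) 1 = (1 - v/u)⁻¹ H(v) E(-u)`, in coefficients. -/
theorem vertexMinus_apply_expInt (a : Fin s) (j : ℤ) (K : ℕ) {N : ℤ} (hN : N < K) :
    vertexMinus a j (expInt ((1 : ℂ) • p a) N) = ∑ i ∈ Finset.range K,
      expInt ((1 : ℂ) • p a) (N - i) * expInt ((-1 : ℂ) • p a) (j + i) := by
  induction K generalizing j N with
  | zero => rw [expInt_of_neg _ (by simpa using hN), map_zero, Finset.sum_range_zero]
  | succ K ih =>
    have h1 := (isVertex_vertexMinus a).apply_expInt_mul_of_neg (d := 1) (by norm_num) j N 1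
    rw [mul_one, mul_one, vertexMinus_one] at h1
    rw [h1, ih (j + 1) (N := N - 1) (by push_cast at hN; omega), Finset.sum_range_succ', add_comm]
    congr 1
    · refine Finset.sum_congr rfl fun i _ => ?_
      rw [show N - 1 - (i : ℤ) = N - (i + 1 : ℕ) by push_cast; ring,
        show j + 1 + (i : ℤ) = j + (i + 1 : ℕ) by push_cast; ring]
    · simp

theorem vertexMinus_zero_apply_expInt (a : Fin s) (N : ℤ) :
    vertexMinus a 0 (expInt ((1 : ℂ) • p a) N) = if N = 0 then 1 else 0 := by
  rcases lt_or_ge N 0 with hN | hN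
  · rw [expInt_of_neg _ hN, map_zero, if_neg hN.ne]
  · lift N to ℕ using hN
    have h := sum_expInt_mul_expInt_neg (p a) N
    rw [vertexMinus_apply_expInt a 0 (N + 1) (by push_cast; omega)]
    simp only [one_smul, neg_one_smul, zero_add]
    rw [h]
    simp

/-- The anticommutator of the modes of `H(u) E^⊥(-u)` and of `E(-u) H^⊥(u)` for one colour; the
shifts by `1` come from the charge. -/
theorem vertexPlus_vertexMinus (a : Fin s) (n k : ℤ) (f : Sym s) :
    vertexPlus a n (vertexMinus a k f) + vertexMinus a (k + 1) (vertexPlus a (n - 1) f) =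
      if n + k = 0 then f else 0 := by
  have hB := isVertex_vertexPlus a
  have hC := isVertex_vertexMinus a
  induction f using Sym.induction_p generalizing n k with
  | h0 z =>
    -- On the vacuum the left-hand side depends on `n + k` only, and it is easy for `k = -1`.
    set F : ℤ → ℤ → Sym s := fun n k => vertexPlus a n (expInt ((-1 : ℂ) • p a) k) +
      vertexMinus a (k + 1) (expInt ((1 : ℂ) • p a) (n - 1)) with hF
    have hstep : ∀ n k, F n k = F (n + 1) (k - 1) := by
      intro n k
      have h1 := hB.apply_expInt_mul_of_neg (d := -1) (by norm_num) n k 1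
      have h2 := hC.apply_expInt_mul_of_neg (d := 1) (by norm_num) k n 1
      rw [mul_one, mul_one, vertexPlus_one] at h1
      rw [mul_one, mul_one, vertexMinus_one] at h2
      simp only [hF, sub_add_cancel, add_sub_cancel_right]
      rw [h1, h2]
      ring
    have hconst : ∀ j : ℤ, F n k = F (n + j) (k - j) := by
      intro j
      induction j using Int.induction_on with
      | zero => simp
      | succ j ih => rw [ih, hstep, add_assoc, sub_sub]
      | pred j ih => rw [ih, hstep (n + (-(j : ℤ) - 1)), ]; congr 1 <;> ring
    have hval : F n k = if n + k = 0 then 1 else 0 := by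
      rw [hconst (k + 1)]
      simp only [hF, sub_add_cancel_left, expInt_of_neg _ (show (-1 : ℤ) < 0 by norm_num),
        map_zero, zero_add, neg_add_cancel]
      rw [vertexMinus_zero_apply_expInt, show n + (k + 1) - 1 = n + k by ring]
    simp only [map_smul, vertexPlus_one, vertexMinus_one]
    rw [← smul_add]
    refine (congrArg (z • ·) hval).trans ?_
    split_ifs <;> simp
  | hadd f g hf hg =>
    simp only [map_add]
    rw [add_add_add_comm, hf, hg]
    split_ifs <;> simp
  | hp b m f ih =>
    simp only [hB _ b, hC _ b]
    have e0 := ih n k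
    have e1 := ih (n + (m : ℕ)) k
    have e2 := ih n (k + (m : ℕ))
    rw [show n + ((m : ℕ) : ℤ) - 1 = n - 1 + (m : ℕ) by ring,
      show n + ((m : ℕ) : ℤ) + k = n + k + (m : ℕ) by ring] at e1
    rw [show k + ((m : ℕ) : ℤ) + 1 = k + 1 + (m : ℕ) by ring,
      show n + (k + ((m : ℕ) : ℤ)) = n + k + (m : ℕ) by ring] at e2
    rw [← e2] at e1
    rw [← mul_ite_zero, ← e0]
    by_cases hb : b = a
    · simp only [map_sub, map_neg, hB _ b, hC _ b, if_pos hb, one_smul, neg_smul]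
      linear_combination -e1
    · simp only [hB _ b, hC _ b, if_neg hb, sub_zero]
      ring

end Relations

section Fermions

variable {s : ℕ}

theorem psiPlus_single (a : Fin s) (n : ℤ) (m : Fin s → ℤ) (f : Sym s) :
    psiPlus a n (AddMonoidAlgebra.single m f) = leftSign a m •
      AddMonoidAlgebra.single (m + Pi.single a 1) (vertexPlus a (n - m a) f) := by
  rw [psiPlus, fockLift_single]
  rfl

theorem psiMinus_single (a : Fin s) (n : ℤ) (m : Fin s → ℤ) (f : Sym s) :
    psiMinus a n (AddMonoidAlgebra.single m f) = leftSign a m •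
      AddMonoidAlgebra.single (m - Pi.single a 1) (vertexMinus a (n + m a) f) := by
  rw [psiMinus, fockLift_single]
  rfl

theorem leftSign_add_single (a b : Fin s) (m : Fin s → ℤ) :
    leftSign a (m + Pi.single b 1) = if b < a then -leftSign a m else leftSign a m := by
  rw [leftSign, leftSign]
  simp only [Pi.add_apply, Finset.sum_add_distrib, Pi.single_apply, Finset.sum_ite_eq',
    Finset.mem_Iio]
  split_ifs with h
  · rw [zpow_add₀ (by norm_num), zpow_one, mul_neg_one]
  · rw [add_zero]

theorem leftSign_sub_single (a b : Fin s) (m : Fin s → ℤ) :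
    leftSign a (m - Pi.single b 1) = if b < a then -leftSign a m else leftSign a m := by
  have h := leftSign_add_single a b (m - Pi.single b 1)
  rw [sub_add_cancel] at h
  split_ifs at h ⊢
  · rw [h, neg_neg]
  · exact h.symm

theorem leftSign_mul_self (a : Fin s) (m : Fin s → ℤ) : leftSign a m * leftSign a m = 1 := by
  rw [leftSign, ← mul_zpow]
  simp

theorem psiPlus_anticomm (a b : Fin s) (n k : ℤ) (x : Fock s) :
    psiPlus a n (psiPlus b k x) + psiPlus b k (psiPlus a n x) = 0 := by
  induction x using AddMonoidAlgebra.induction_linear with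
  | zero => simp
  | add x y hx hy =>
    simp only [map_add]
    rw [add_add_add_comm, hx, hy, add_zero]
  | single m f =>
    simp only [psiPlus_single, map_smul, smul_smul, Pi.add_apply, leftSign_add_single]
    rcases lt_trichotomy a b with h | h | h
    · have hne : a ≠ b := h.ne
      simp only [if_pos h, if_neg h.not_gt, Pi.single_eq_of_ne hne, Pi.single_eq_of_ne hne.symm,
        add_zero]
      rw [(isVertex_vertexPlus a).comm_of_ne hne (isVertex_vertexPlus b) (vertexPlus_one a)
        (vertexPlus_one b), add_right_comm m, mul_neg, mul_comm, neg_smul, add_neg_cancel]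
    · subst h
      simp only [lt_irrefl, if_false, Pi.single_eq_same]
      rw [← smul_add, ← AddMonoidAlgebra.single_add, ← sub_sub, ← sub_sub,
        (isVertex_vertexPlus a).anticomm (one_mul 1) (vertexPlus_one a),
        AddMonoidAlgebra.single_zero, smul_zero]
    · have hne : a ≠ b := h.ne'
      simp only [if_pos h, if_neg h.not_gt, Pi.single_eq_of_ne hne, Pi.single_eq_of_ne hne.symm,
        add_zero]
      rw [(isVertex_vertexPlus a).comm_of_ne hne (isVertex_vertexPlus b) (vertexPlus_one a)
        (vertexPlus_one b), add_right_comm m, mul_neg, mul_comm, neg_smul, neg_add_cancel]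

theorem psiMinus_psiPlus_anticomm (a b : Fin s) (n k : ℤ) (x : Fock s) :
    psiMinus a n (psiPlus b k x) + psiPlus b k (psiMinus a n x) =
      if a = b ∧ n + k = -1 then x else 0 := by
  induction x using AddMonoidAlgebra.induction_linear with
  | zero => simp
  | add x y hx hy =>
    simp only [map_add]
    rw [add_add_add_comm, hx, hy]
    split_ifs <;> simp
  | single m f =>
    simp only [psiPlus_single, psiMinus_single, map_smul, smul_smul, Pi.add_apply, Pi.sub_apply,
      leftSign_add_single, leftSign_sub_single]
    by_cases h : a = b
    · subst h
      simp only [lt_irrefl, if_false, Pi.single_eq_same, true_and, add_sub_cancel_right,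
        sub_add_cancel, leftSign_mul_self, one_smul]
      rw [← AddMonoidAlgebra.single_add, add_comm (vertexMinus a _ _),
        show k - (m a - 1) = k - m a + 1 by ring, ← add_assoc]
      have h1 := vertexPlus_vertexMinus a (k - m a + 1) (n + m a) f
      rw [add_sub_cancel_right] at h1
      rw [h1, apply_ite (AddMonoidAlgebra.single m), AddMonoidAlgebra.single_zero]
      exact if_congr (by omega) rfl rfl
    · have hcomm := (isVertex_vertexMinus a).comm_of_ne h (isVertex_vertexPlus b)
        (vertexMinus_one a) (vertexPlus_one b)
      have hn : ¬(a = b ∧ n + k = -1) := fun h' => h h'.1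
      simp only [Pi.single_eq_of_ne h, Pi.single_eq_of_ne (Ne.symm h), add_zero, sub_zero, if_neg hn]
      rw [hcomm, add_sub_right_comm]
      rcases lt_or_gt_of_ne h with h' | h'
      · simp only [if_pos h', if_neg h'.not_gt]
        rw [mul_neg, mul_comm, neg_smul, add_neg_cancel]
      · simp only [if_pos h', if_neg h'.not_gt]
        rw [mul_neg, mul_comm, neg_smul, neg_add_cancel]

theorem one_eq_single : (1 : Fock s) = AddMonoidAlgebra.single 0 1 := rfl

theorem psiPlus_one_of_neg (a : Fin s) {n : ℤ} (hn : n < 0) : psiPlus a n 1 = 0 := by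
  rw [one_eq_single, psiPlus_single, Pi.zero_apply, sub_zero, vertexPlus_one,
    expInt_of_neg _ hn, AddMonoidAlgebra.single_zero, smul_zero]

theorem psiMinus_one_of_neg (a : Fin s) {n : ℤ} (hn : n < 0) : psiMinus a n 1 = 0 := by
  rw [one_eq_single, psiMinus_single, Pi.zero_apply, add_zero, vertexMinus_one,
    expInt_of_neg _ hn, AddMonoidAlgebra.single_zero, smul_zero]

end Fermions

/-! ### Combinations of fermions and the operator `Ω` -/

section Field

variable {s : ℕ}

/-- The finite linear combination `∑ c(a, n) ψ⁺⁽ᵃ⁾_n` of fermion modes, where `ψ⁺⁽ᵃ⁾_n` is the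
coefficient of `u^n`. -/
noncomputable def fermion (c : (Fin s × ℤ) →₀ ℂ) : Module.End ℂ (Fock s) :=
  c.sum fun x r => r • psiPlus x.1 x.2

theorem fermion_apply (c : (Fin s × ℤ) →₀ ℂ) (x : Fock s) :
    fermion c x = c.sum fun i r => r • psiPlus i.1 i.2 x := by
  simp [fermion, Finsupp.sum]

theorem psiPlus_fermion (c : (Fin s × ℤ) →₀ ℂ) (a : Fin s) (n : ℤ) (x : Fock s) :
    psiPlus a n (fermion c x) = -fermion c (psiPlus a n x) := by
  rw [fermion_apply, fermion_apply, Finsupp.sum, Finsupp.sum, map_sum, ← Finset.sum_neg_distrib]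
  refine Finset.sum_congr rfl fun i _ => ?_
  rw [map_smul, eq_neg_of_add_eq_zero_left (psiPlus_anticomm a i.1 n i.2 x), smul_neg]

theorem fermion_fermion (c : (Fin s × ℤ) →₀ ℂ) (x : Fock s) : fermion c (fermion c x) = 0 := by
  have h : fermion c (fermion c x) = -fermion c (fermion c x) := by
    conv_lhs => rw [fermion_apply]
    conv_rhs => rw [fermion_apply c x]
    simp only [Finsupp.sum, psiPlus_fermion, smul_neg, Finset.sum_neg_distrib, map_sum, map_smul]
  have h2 : (2 : ℂ) • fermion c (fermion c x) = 0 := by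
    rw [two_smul]
    exact eq_neg_iff_add_eq_zero.mp h
  exact (smul_eq_zero.mp h2).resolve_left two_ne_zero

theorem psiMinus_fermion (c : (Fin s × ℤ) →₀ ℂ) (a : Fin s) (n : ℤ) (x : Fock s) :
    psiMinus a n (fermion c x) = c (a, -n - 1) • x - fermion c (psiMinus a n x) := by
  have h : ∀ i : Fin s × ℤ, psiMinus a n (psiPlus i.1 i.2 x) =
      (if i = (a, -n - 1) then x else 0) - psiPlus i.1 i.2 (psiMinus a n x) := by
    intro i
    rw [eq_sub_iff_add_eq, psiMinus_psiPlus_anticomm]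
    refine if_congr ?_ rfl rfl
    rw [Prod.ext_iff]
    constructor
    · rintro ⟨h1, h2⟩
      exact ⟨h1.symm, by dsimp only; omega⟩
    · rintro ⟨h1, h2⟩
      exact ⟨h1.symm, by dsimp only at h2; omega⟩
  rw [fermion_apply, fermion_apply, Finsupp.sum, Finsupp.sum, map_sum]
  simp only [map_smul, h, smul_sub, Finset.sum_sub_distrib, smul_ite, smul_zero]
  rw [Finset.sum_ite_eq']
  split_ifs with h0
  · rfl
  · rw [Finsupp.notMem_support_iff.mp h0, zero_smul]

theorem Omega_tmul (x y : Fock s) : Omega s (x ⊗ₜ[ℂ] y) =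
    ∑ a : Fin s, ∑ᶠ n : ℤ, psiPlus a n x ⊗ₜ[ℂ] psiMinus a (-n - 1) y := by
  rw [Omega, LinearMap.sum_apply]
  rfl

/-- `Ω` commutes with `Ψ ⊗ Ψ` for every combination `Ψ` of the `ψ⁺⁽ᵃ⁾_n`: the correction term
produced by the anticommutators with `ψ⁻` is `Ψ² ⊗ 1 = 0`. -/
theorem Omega_fermion_tmul (c : (Fin s × ℤ) →₀ ℂ) (x y : Fock s) :
    Omega s (fermion c x ⊗ₜ[ℂ] fermion c y) =
      TensorProduct.map (fermion c) (fermion c) (Omega s (x ⊗ₜ[ℂ] y)) := by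
  have hterm : ∀ (a : Fin s) (n : ℤ),
      psiPlus a n (fermion c x) ⊗ₜ[ℂ] psiMinus a (-n - 1) (fermion c y) +
        (c (a, n) • fermion c (psiPlus a n x)) ⊗ₜ[ℂ] y =
        TensorProduct.map (fermion c) (fermion c)
          (psiPlus a n x ⊗ₜ[ℂ] psiMinus a (-n - 1) y) := by
    intro a n
    rw [psiPlus_fermion, psiMinus_fermion, show -(-n - 1) - 1 = n by ring,
      TensorProduct.map_tmul, TensorProduct.tmul_sub, TensorProduct.neg_tmul,
      TensorProduct.neg_tmul, TensorProduct.tmul_smul, TensorProduct.smul_tmul']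
    abel
  have hfin1 : ∀ a : Fin s, (Function.support fun n : ℤ =>
      psiPlus a n x ⊗ₜ[ℂ] psiMinus a (-n - 1) y).Finite := fun a => finite_omega a (x ⊗ₜ[ℂ] y)
  have hsub : ∀ a : Fin s, (Function.support fun n : ℤ =>
      (c (a, n) • fermion c (psiPlus a n x)) ⊗ₜ[ℂ] y) ⊆ ↑(c.support.image Prod.snd) := by
    intro a n hn
    rw [Finset.mem_coe, Finset.mem_image]
    refine ⟨(a, n), ?_, rfl⟩
    by_contra h0
    exact hn (by simp [Finsupp.notMem_support_iff.mp h0])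
  have hzero : ∑ a : Fin s, ∑ᶠ n : ℤ, (c (a, n) • fermion c (psiPlus a n x)) ⊗ₜ[ℂ] y = 0 := by
    have h1 : c.sum (fun i r => r • fermion c (psiPlus i.1 i.2 x)) = 0 := by
      rw [← fermion_fermion c x, fermion_apply c x, Finsupp.sum, Finsupp.sum, map_sum]
      simp only [map_smul]
    simp only [finsum_eq_sum_of_support_subset _ (hsub _)]
    simp only [← TensorProduct.sum_tmul]
    rw [← Finset.sum_product' Finset.univ (c.support.image Prod.snd)
      fun a n => c (a, n) • fermion c (psiPlus a n x)]
    rw [Finsupp.sum_of_support_subset (s := Finset.univ ×ˢ c.support.image Prod.snd)] at h1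
    · rw [h1, TensorProduct.zero_tmul]
    · intro i hi
      exact Finset.mem_product.mpr ⟨Finset.mem_univ _, Finset.mem_image_of_mem _ hi⟩
    · intro i _
      exact zero_smul _ _
  rw [Omega_tmul, Omega_tmul, map_sum, ← add_zero (∑ a : Fin s, _), ← hzero,
    ← Finset.sum_add_distrib]
  refine Finset.sum_congr rfl fun a _ => ?_
  refine (finsum_add_distrib (finite_omega a (fermion c x ⊗ₜ[ℂ] fermion c y))
    ((Finset.finite_toSet _).subset (hsub a))).symm.trans ?_
  refine (finsum_congr (hterm a)).trans ?_
  exact (AddMonoidHom.map_finsum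
    (TensorProduct.map (fermion c) (fermion c)).toAddMonoidHom (hfin1 a)).symm

theorem Omega_one_tmul_one : Omega s ((1 : Fock s) ⊗ₜ[ℂ] (1 : Fock s)) = 0 := by
  rw [Omega_tmul]
  refine Finset.sum_eq_zero fun a _ => ?_
  refine finsum_eq_zero_of_forall_eq_zero fun n => ?_
  rcases lt_or_ge n 0 with hn | hn
  · rw [psiPlus_one_of_neg a hn, TensorProduct.zero_tmul]
  · rw [psiMinus_one_of_neg a (by omega), TensorProduct.tmul_zero]

/-- The vectors `Ψ_1 ⋯ Ψ_k 1` solve the bilinear identity. -/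
theorem Omega_list_prod_fermion (L : List ((Fin s × ℤ) →₀ ℂ)) :
    Omega s ((L.map fermion).prod (1 : Fock s) ⊗ₜ[ℂ] (L.map fermion).prod (1 : Fock s)) = 0 := by
  induction L with
  | nil => exact Omega_one_tmul_one
  | cons c L ih =>
    rw [List.map_cons, List.prod_cons, Module.End.mul_apply, Omega_fermion_tmul, ih, map_zero]

end Field

/-! ### Products over pairs -/

/-- The product of `w j i` over the pairs of entries of a list with `i` standing before `j`. -/
def pairProd {ι M : Type*} [Monoid M] (w : ι → ι → M) : List ι → M
  | [] => 1
  | i :: L => (L.map fun j => w j i).prod * pairProd w L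

theorem pairProd_eq_prod_filter {ι M : Type*} [LinearOrder ι] [CommMonoid M] (w : ι → ι → M)
    {L : List ι} (hL : L.Pairwise (· > ·)) : pairProd w L =
      ∏ i ∈ L.toFinset, ∏ j ∈ L.toFinset.filter (i < ·), w i j := by
  induction L with
  | nil => rfl
  | cons k L ih =>
    rw [List.pairwise_cons] at hL
    have hk : k ∉ L.toFinset := fun h => lt_irrefl k (hL.1 k (List.mem_toFinset.mp h))
    have h1 : ∏ j ∈ (insert k L.toFinset).filter (k < ·), w k j = 1 := by
      refine Finset.prod_eq_one fun j hj => ?_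
      rw [Finset.mem_filter, Finset.mem_insert] at hj
      rcases hj.1 with rfl | h
      · exact absurd hj.2 (lt_irrefl j)
      · exact absurd hj.2 (hL.1 j (List.mem_toFinset.mp h)).not_gt
    have h2 : ∀ i ∈ L.toFinset, ∏ j ∈ (insert k L.toFinset).filter (i < ·), w i j =
        w i k * ∏ j ∈ L.toFinset.filter (i < ·), w i j := by
      intro i hi
      rw [Finset.filter_insert, if_pos (hL.1 i (List.mem_toFinset.mp hi)),
        Finset.prod_insert fun h => hk (Finset.mem_filter.mp h).1]
    rw [List.toFinset_cons, Finset.prod_insert hk, h1, one_mul, Finset.prod_congr rfl h2,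
      Finset.prod_mul_distrib, ← ih hL.2, pairProd,
      List.prod_toFinset _ (hL.2.imp fun h => h.ne')]

theorem pairProd_reverse_finRange {l : ℕ} {M : Type*} [CommMonoid M] (w : Fin l → Fin l → M) :
    pairProd w (List.finRange l).reverse = ∏ i, ∏ j ∈ Finset.Ioi i, w i j := by
  rw [pairProd_eq_prod_filter w (List.pairwise_reverse.mpr (List.pairwise_lt_finRange l))]
  have h : (List.finRange l).reverse.toFinset = Finset.univ := by
    ext i
    simp
  rw [h]
  refine Finset.prod_congr rfl fun i _ => Finset.prod_congr ?_ fun _ _ => rfl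
  ext j
  simp

/-! ### Products of fermions applied to the vacuum -/

section States

variable {s l : ℕ}

/-- Formal distributions `∑ F(β) u^β` in `u_1, …, u_l` with coefficients symmetric functions. -/
abbrev Distr (s l : ℕ) : Type := (Fin l → ℤ) → Sym s

/-- Multiplication of a formal distribution by `u_i`. -/
noncomputable def mulU (i : Fin l) : Module.End ℂ (Distr s l) :=
  LinearMap.funLeft ℂ (Sym s) fun β => β - Pi.single i 1

/-- Multiplication of a formal distribution by `(u_i - u_j)^{δ_{a_i, a_j}}`; as in
`∏_{i<j} (u_j - u_i)`, the first index is that of the subtracted variable. -/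
noncomputable def mulDiff (a : Fin l → Fin s) (j i : Fin l) : Module.End ℂ (Distr s l) :=
  if a j = a i then mulU i - mulU j else 1

/-- The operator `F(β) ↦ h_{β_i}⁽ᵇ⁾ F(β)`, i.e. multiplication by `H⁽ᵇ⁾(u_i)` of a distribution
which does not involve `u_i`. -/
noncomputable def mulH (a : Fin l → Fin s) (i : Fin l) : Module.End ℂ (Distr s l) :=
  LinearMap.pi fun β => LinearMap.mulLeft ℂ (expInt ((1 : ℂ) • p (a i)) (β i)) ∘ₗ
    LinearMap.proj β

/-- The operator `F(β) ↦ V_{β_i - c} F(β)` where `V_n` are the modes of the vertex operator. -/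
noncomputable def applyVertex (a : Fin l → Fin s) (i : Fin l) (c : ℤ) :
    Module.End ℂ (Distr s l) :=
  LinearMap.pi fun β => vertexPlus (a i) (β i - c) ∘ₗ LinearMap.proj β

theorem mulU_apply (i : Fin l) (F : Distr s l) (β : Fin l → ℤ) :
    mulU i F β = F (β - Pi.single i 1) := rfl

theorem mulH_apply (a : Fin l → Fin s) (i : Fin l) (F : Distr s l) (β : Fin l → ℤ) :
    mulH a i F β = expInt ((1 : ℂ) • p (a i)) (β i) * F β := rfl

theorem applyVertex_apply (a : Fin l → Fin s) (i : Fin l) (c : ℤ) (F : Distr s l)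
    (β : Fin l → ℤ) : applyVertex a i c F β = vertexPlus (a i) (β i - c) (F β) := rfl

theorem mulU_commute (i j : Fin l) : Commute (mulU (s := s) i) (mulU j) := by
  refine LinearMap.ext fun F => funext fun β => ?_
  simp only [Module.End.mul_apply, mulU_apply]
  rw [sub_right_comm]

theorem commute_mulDiff {a : Fin l → Fin s} {i j : Fin l} {X : Module.End ℂ (Distr s l)}
    (hi : Commute X (mulU i)) (hj : Commute X (mulU j)) : Commute X (mulDiff a j i) := by
  rw [mulDiff]
  split_ifs
  · exact hi.sub_right hj
  · exact Commute.one_right X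

theorem mulH_commute_mulU (a : Fin l → Fin s) {i j : Fin l} (hij : i ≠ j) :
    Commute (mulH a i) (mulU j) := by
  refine LinearMap.ext fun F => funext fun β => ?_
  simp only [Module.End.mul_apply, mulU_apply, mulH_apply, Pi.sub_apply,
    Pi.single_eq_of_ne hij, sub_zero]

theorem applyVertex_commute_mulU (a : Fin l → Fin s) {i j : Fin l} (hij : i ≠ j) (c : ℤ) :
    Commute (applyVertex a i c) (mulU j) := by
  refine LinearMap.ext fun F => funext fun β => ?_
  simp only [Module.End.mul_apply, mulU_apply, applyVertex_apply, Pi.sub_apply,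
    Pi.single_eq_of_ne hij, sub_zero]

theorem mulH_commute (a : Fin l → Fin s) (i j : Fin l) : Commute (mulH a i) (mulH a j) := by
  refine LinearMap.ext fun F => funext fun β => ?_
  simp only [Module.End.mul_apply, mulH_apply]
  ring

theorem commute_pairProd_mulDiff {a : Fin l → Fin s} {X : Module.End ℂ (Distr s l)}
    {L : List (Fin l)} (hX : ∀ i ∈ L, Commute X (mulU i)) :
    Commute X (pairProd (mulDiff a) L) := by
  induction L with
  | nil => exact Commute.one_right X
  | cons i L ih =>
    refine Commute.mul_right (Commute.list_prod_right _ _ fun Y hY => ?_)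
      (ih fun j hj => hX j (List.mem_cons_of_mem _ hj))
    obtain ⟨j, hj, rfl⟩ := List.mem_map.mp hY
    exact commute_mulDiff (hX i List.mem_cons_self) (hX j (List.mem_cons_of_mem _ hj))

/-- The distribution `∏_{i ∈ L} H^{(a_i)}(u_i)`, constant in the exponents outside `L`. -/
noncomputable def prodH (a : Fin l → Fin s) (L : List (Fin l)) : Distr s l :=
  (L.map (mulH a)).prod 1

theorem prodH_cons (a : Fin l → Fin s) (i : Fin l) (L : List (Fin l)) :
    prodH a (i :: L) = mulH a i (prodH a L) := by
  rw [prodH, List.map_cons, List.prod_cons]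
  rfl

theorem mulU_prodH (a : Fin l → Fin s) {i : Fin l} {L : List (Fin l)} (hi : i ∉ L) :
    mulU i (prodH a L) = prodH a L := by
  induction L with
  | nil => rfl
  | cons j L ih =>
    rw [List.mem_cons, not_or] at hi
    rw [prodH_cons, ← Module.End.mul_apply,
      ← (mulH_commute_mulU a (Ne.symm hi.1)).eq, Module.End.mul_apply, ih hi.2]

/-- `u^m V(u) ∏_j H^{(a_j)}(u_j) = ∏_j (u - u_j)^{δ_{a, a_j}} H⁽ᵃ⁾(u) ∏_j H^{(a_j)}(u_j)`, where `m`
is the number of the `j` with `a_j = a`. -/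
theorem applyVertex_prodH (a : Fin l → Fin s) {i : Fin l} {L : List (Fin l)} (hi : i ∉ L)
    (hL : L.Nodup) : applyVertex a i (L.countP fun j => a j = a i) (prodH a L) =
      (L.map fun j => mulDiff a j i).prod (mulH a i (prodH a L)) := by
  induction L with
  | nil =>
    funext β
    rw [applyVertex_apply]
    simp only [List.countP_nil, Nat.cast_zero, sub_zero, List.map_nil, List.prod_nil]
    exact (vertexPlus_one _ _).trans (mul_one _).symm
  | cons j L ih =>
    rw [List.mem_cons, not_or] at hi
    rw [List.nodup_cons] at hL
    have hcomm : Commute (mulH a j) (L.map fun k => mulDiff a k i).prod := by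
      refine Commute.list_prod_right _ _ fun Y hY => ?_
      obtain ⟨k, hk, rfl⟩ := List.mem_map.mp hY
      exact commute_mulDiff (mulH_commute_mulU a (Ne.symm hi.1))
        (mulH_commute_mulU a fun h => hL.1 (h ▸ hk))
    have key : (L.map fun k => mulDiff a k i).prod (mulH a i (prodH a (j :: L))) =
        mulH a j (applyVertex a i (L.countP fun j => a j = a i) (prodH a L)) := by
      rw [ih hi.2 hL.2, prodH_cons, ← Module.End.mul_apply (mulH a i), (mulH_commute a i j).eq,
        Module.End.mul_apply, ← Module.End.mul_apply _ (mulH a j), ← hcomm.eq]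
      rfl
    rw [List.map_cons, List.prod_cons, Module.End.mul_apply, key, prodH_cons]
    have h0i := fun β => congrFun (mulU_prodH a hi.2) β
    have h0j := fun β => congrFun (mulU_prodH a hL.1) β
    simp only [mulU_apply] at h0i h0j
    funext β
    by_cases h : a j = a i
    · rw [mulDiff, if_pos h, List.countP_cons_of_pos (by simpa using h)]
      simp only [LinearMap.sub_apply, Pi.sub_apply, mulU_apply, mulH_apply, applyVertex_apply, h0i,
        h0j, Pi.single_eq_same, Pi.single_eq_of_ne hi.1, Pi.single_eq_of_ne (Ne.symm hi.1),
        sub_zero]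
      rw [h, (isVertex_vertexPlus (a i)).apply_expInt_mul (one_mul 1)]
      push_cast
      rw [show β i - ((L.countP fun j => a j = a i : ℕ) + 1 : ℤ) + 1 =
          β i - (L.countP fun j => a j = a i : ℕ) by ring,
        show β i - ((L.countP fun j => a j = a i : ℕ) + 1 : ℤ) =
          β i - 1 - (L.countP fun j => a j = a i : ℕ) by ring]
    · rw [mulDiff, if_neg h, List.countP_cons_of_neg (by simpa using h)]
      simp only [Module.End.one_apply, mulH_apply, applyVertex_apply]
      rw [(isVertex_vertexPlus (a i)).apply_expInt_mul_of_ne _ h]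

/-- The exponent `∑_{i ∈ L} e_{a_i}` of `∏_{i ∈ L} z_{a_i}`. -/
def weight (a : Fin l → Fin s) (L : List (Fin l)) : Fin s → ℤ :=
  (L.map fun i => Pi.single (a i) 1).sum

theorem weight_cons (a : Fin l → Fin s) (i : Fin l) (L : List (Fin l)) :
    weight a (i :: L) = Pi.single (a i) 1 + weight a L := by
  rw [weight, List.map_cons, List.sum_cons]
  rfl

theorem weight_apply (a : Fin l → Fin s) (L : List (Fin l)) (b : Fin s) :
    weight a L b = L.countP fun j => a j = b := by
  induction L with
  | nil => rfl
  | cons i L ih =>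
    rw [weight_cons, Pi.add_apply, ih, List.countP_cons, Pi.single_apply]
    by_cases h : a i = b
    · simp [h, add_comm]
    · simp [h, Ne.symm h]

theorem leftSign_weight (a : Fin l → Fin s) (L : List (Fin l)) (b : Fin s) :
    leftSign b (weight a L) = (-1) ^ (L.map a).countP fun c => decide (c < b) := by
  induction L with
  | nil => simp [leftSign, weight]
  | cons i L ih =>
    rw [weight_cons, add_comm, leftSign_add_single, ih, List.map_cons, List.countP_cons]
    split_ifs with h1 h2 h2
    · rw [pow_succ, mul_neg_one]
    · exact absurd (by simpa using h1) h2
    · exact absurd (by simpa using h2) h1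
    · rw [add_zero]

/-- In coefficients: the product of the `ψ^{+(a_i)}(u_i)`, `i ∈ L`, applied to the vacuum is
`ε ∏ z_{a_i} ∏ (u_i - u_j)^{δ_{a_i, a_j}} ∏ H^{(a_i)}(u_i)`, where the middle product is over the
pairs with `i` before `j` in `L`. -/
theorem list_prod_psiPlus_one (a : Fin l → Fin s) {L : List (Fin l)} (hL : L.Nodup)
    (β : Fin l → ℤ) : (L.map fun i => psiPlus (a i) (β i)).prod (1 : Fock s) =
      ((eps (L.map a) : ℤ) : ℂ) • AddMonoidAlgebra.single (weight a L)
        (pairProd (mulDiff a) L (prodH a L) β) := by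
  induction L with
  | nil =>
    simp only [List.map_nil, List.prod_nil, eps, Int.cast_one, one_smul]
    rfl
  | cons i L ih =>
    rw [List.nodup_cons] at hL
    have h1 : vertexPlus (a i) (β i - weight a L (a i)) (pairProd (mulDiff a) L (prodH a L) β) =
        pairProd (mulDiff a) (i :: L) (prodH a (i :: L)) β := by
      rw [weight_apply, ← applyVertex_apply, ← Module.End.mul_apply (applyVertex _ _ _),
        (commute_pairProd_mulDiff fun j hj =>
          applyVertex_commute_mulU a (fun h : i = j => hL.1 (h.symm ▸ hj)) _).eq, Module.End.mul_apply,
        applyVertex_prodH a hL.1 hL.2, ← prodH_cons, ← Module.End.mul_apply]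
      have h2 : Commute (L.map fun j => mulDiff a j i).prod (pairProd (mulDiff a) L) :=
        commute_pairProd_mulDiff fun j _ => (Commute.list_prod_right _ _ fun Y hY => by
          obtain ⟨k, _, rfl⟩ := List.mem_map.mp hY
          exact commute_mulDiff (mulU_commute _ _) (mulU_commute _ _)).symm
      rw [← h2.eq]
      rfl
    rw [List.map_cons, List.prod_cons, Module.End.mul_apply, ih hL.2, map_smul, psiPlus_single, h1,
      smul_smul, leftSign_weight, List.map_cons, eps, weight_cons, add_comm]
    congr 1
    push_cast
    rw [mul_comm]

end States

/-! ### Coefficients of Laurent series in several variables -/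

section Coefficients

theorem coeff_mul_eq_sum {Γ R : Type*} [PartialOrder Γ] [AddCommGroup Γ] [IsOrderedAddMonoid Γ]
    [DecidableEq Γ] [Semiring R] (X Y : HahnSeries Γ R) (α : Γ) (S : Finset Γ)
    (hS : ∀ n ∉ S, X.coeff (α - n) * Y.coeff n = 0) :
    (X * Y).coeff α = ∑ n ∈ S, X.coeff (α - n) * Y.coeff n := by
  set D := Finset.antidiagonal X.isPWO_support Y.isPWO_support α with hD
  have hfst : ∀ q ∈ D, q.1 = α - q.2 := fun q hq =>
    eq_sub_of_add_eq (Finset.mem_antidiagonal.mp hq).2.2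
  have h1 : (X * Y).coeff α = ∑ n ∈ D.image Prod.snd, X.coeff (α - n) * Y.coeff n := by
    rw [HahnSeries.coeff_mul, Finset.sum_image]
    · exact Finset.sum_congr rfl fun q hq => by rw [hfst q hq]
    · intro q hq q' hq' h
      exact Prod.ext (by rw [hfst q hq, hfst q' hq', h]) h
  rw [h1]
  refine Finset.sum_congr_of_eq_on_inter (fun n _ hn => hS n hn) (fun n _ hn => ?_)
    fun _ _ _ => rfl
  by_contra h0
  refine hn (Finset.mem_image.mpr ⟨(α - n, n), Finset.mem_antidiagonal.mpr ⟨?_, ?_, ?_⟩, rfl⟩)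
  · exact fun h => h0 (by rw [h, zero_mul])
  · exact fun h => h0 (by rw [h, mul_zero])
  · exact sub_add_cancel α n

variable {l : ℕ} {R : Type} [CommRing R]

theorem coeff_substVar_single (i : Fin l) (F : LaurentSeries R) (n : ℤ) :
    (substVar i F).coeff (Pi.single i n) = F.coeff n :=
  HahnSeries.embDomain_mk_coeff (f := fun n : ℤ => (Pi.single i n : Fin l → ℤ)) _ _

theorem coeff_substVar_eq_zero (i : Fin l) (F : LaurentSeries R) {β : Fin l → ℤ}
    (hβ : β ≠ Pi.single i (β i)) : (substVar i F).coeff β = 0 := by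
  refine HahnSeries.embDomain_of_notMem_range ?_
  rintro ⟨n, rfl⟩
  refine hβ ?_
  change (Pi.single i n : Fin l → ℤ) = Pi.single i ((Pi.single i n : Fin l → ℤ) i)
  rw [Pi.single_eq_same]

/-- If `G` does not involve `u_i`, only one term contributes to each coefficient of `F(u_i) G`. -/
theorem coeff_substVar_mul (i : Fin l) (F : LaurentSeries R) (G : MultiLaurent l R)
    (hG : ∀ γ, G.coeff γ ≠ 0 → γ i = 0) (β : Fin l → ℤ) :
    (substVar i F * G).coeff β = F.coeff (β i) * G.coeff (β - Pi.single i (β i)) := by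
  rw [coeff_mul_eq_sum _ _ β {β - Pi.single i (β i)}, Finset.sum_singleton, sub_sub_cancel,
    coeff_substVar_single]
  intro n hn
  rw [Finset.mem_singleton] at hn
  by_cases h0 : G.coeff n = 0
  · rw [h0, mul_zero]
  · rw [coeff_substVar_eq_zero, zero_mul]
    intro h1
    rw [Pi.sub_apply, hG n h0, sub_zero] at h1
    exact hn (by rw [← h1, sub_sub_cancel])

theorem coeff_prod_substVar_finset (F : Fin l → LaurentSeries R) (S : Finset (Fin l))
    (β : Fin l → ℤ) : (∏ j ∈ S, substVar j (F j)).coeff β =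
      if ∀ j ∉ S, β j = 0 then ∏ j ∈ S, (F j).coeff (β j) else 0 := by
  induction S using Finset.induction generalizing β with
  | empty =>
    rw [Finset.prod_empty, Finset.prod_empty, HahnSeries.coeff_one]
    by_cases hβ : β = 0
    · rw [if_pos hβ, if_pos fun j _ => by rw [hβ, Pi.zero_apply]]
    · rw [if_neg hβ, if_neg fun h => hβ (funext fun j => h j (Finset.notMem_empty j))]
  | insert i S hi ih =>
    rw [Finset.prod_insert hi, coeff_substVar_mul, ih, Finset.prod_insert hi, mul_ite_zero]
    · have h1 : (∀ j ∉ S, (β - Pi.single i (β i) : Fin l → ℤ) j = 0) ↔ ∀ j ∉ insert i S, β j = 0 := by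
        constructor
        · intro h j hj
          rw [Finset.mem_insert, not_or] at hj
          have := h j hj.2
          rwa [Pi.sub_apply, Pi.single_eq_of_ne hj.1, sub_zero] at this
        · intro h j hj
          by_cases hji : j = i
          · rw [hji, Pi.sub_apply, Pi.single_eq_same, sub_self]
          · rw [Pi.sub_apply, Pi.single_eq_of_ne hji, sub_zero]
            exact h j (by simp [hji, hj])
      refine if_congr h1 ?_ rfl
      congr 1
      refine Finset.prod_congr rfl fun j hj => ?_
      rw [Pi.sub_apply, Pi.single_eq_of_ne (fun h : j = i => hi (h ▸ hj)), sub_zero]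
    · intro γ hγ
      rw [ih] at hγ
      by_contra h0
      exact hγ (if_neg fun h => h0 (h i hi))

theorem coeff_prod_substVar (F : Fin l → LaurentSeries R) (β : Fin l → ℤ) :
    (∏ j, substVar j (F j)).coeff β = ∏ j, (F j).coeff (β j) := by
  rw [coeff_prod_substVar_finset, if_pos]
  exact fun j hj => absurd (Finset.mem_univ j) hj

end Coefficients

/-! ### The generating function as a product of fermions -/

section Generating

variable {s l : ℕ}

theorem coeff_H (a : Fin s) (n : ℤ) :
    (HahnSeries.ofPowerSeries ℤ (Sym s) (PowerSeries.mk (h a))).coeff n =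
      expInt ((1 : ℂ) • p a) n := by
  rcases lt_or_ge n 0 with hn | hn
  · rw [expInt_of_neg _ hn, HahnSeries.ofPowerSeries_apply]
    refine HahnSeries.embDomain_of_notMem_range ?_
    rintro ⟨k, hk⟩
    have : (k : ℤ) = n := hk
    omega
  · lift n to ℕ using hn
    rw [HahnSeries.ofPowerSeries_apply_coeff, PowerSeries.coeff_mk, expInt_natCast, one_smul]
    rfl

/-- The factor `(u_j - u_i)^{δ_{a_i, a_j}}`. -/
noncomputable def diffFactor (a : Fin l → Fin s) (i j : Fin l) : MultiLaurent l (Sym s) :=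
  if a i = a j then uPow j 1 - uPow i 1 else 1

theorem coeff_uPow_mul (i : Fin l) (X : MultiLaurent l (Sym s)) :
    (uPow i 1 * X).coeff = mulU i X.coeff := by
  funext β
  rw [uPow, HahnSeries.coeff_single_mul, one_mul, mulU_apply]

theorem coeff_diffFactor_mul (a : Fin l → Fin s) (i j : Fin l) (X : MultiLaurent l (Sym s)) :
    (diffFactor a i j * X).coeff = mulDiff a i j X.coeff := by
  rw [diffFactor, mulDiff]
  split_ifs
  · rw [sub_mul, HahnSeries.coeff_sub', coeff_uPow_mul, coeff_uPow_mul]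
    rfl
  · rw [one_mul]
    rfl

theorem coeff_list_prod_diffFactor_mul (a : Fin l → Fin s) (i : Fin l) (L : List (Fin l))
    (X : MultiLaurent l (Sym s)) : ((L.map fun j => diffFactor a j i).prod * X).coeff =
      (L.map fun j => mulDiff a j i).prod X.coeff := by
  induction L with
  | nil =>
    rw [List.map_nil, List.prod_nil, one_mul]
    rfl
  | cons j L ih =>
    rw [List.map_cons, List.prod_cons, mul_assoc, coeff_diffFactor_mul, ih]
    rfl

theorem coeff_pairProd_diffFactor_mul (a : Fin l → Fin s) (L : List (Fin l))
    (X : MultiLaurent l (Sym s)) : (pairProd (diffFactor a) L * X).coeff =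
      pairProd (mulDiff a) L X.coeff := by
  induction L with
  | nil =>
    rw [pairProd, one_mul]
    rfl
  | cons i L ih =>
    rw [pairProd, mul_assoc, coeff_list_prod_diffFactor_mul, ih]
    rfl

theorem prodH_apply (a : Fin l → Fin s) (L : List (Fin l)) (β : Fin l → ℤ) :
    prodH a L β = (L.map fun j => expInt ((1 : ℂ) • p (a j)) (β j)).prod := by
  induction L with
  | nil => rfl
  | cons i L ih => rw [prodH_cons, mulH_apply, ih, List.map_cons, List.prod_cons]

/-- The indices `l, …, 1` in decreasing order. -/
abbrev decr (l : ℕ) : List (Fin l) := (List.finRange l).reverse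

theorem prod_map_decr {M : Type*} [CommMonoid M] (f : Fin l → M) :
    ((decr l).map f).prod = ∏ i, f i := by
  rw [List.map_reverse, List.prod_reverse, ← List.ofFn_eq_map, List.prod_ofFn]

theorem sum_map_decr {M : Type*} [AddCommMonoid M] (f : Fin l → M) :
    ((decr l).map f).sum = ∑ i, f i := by
  rw [List.map_reverse, List.sum_reverse, ← List.ofFn_eq_map, List.sum_ofFn]

/-- All exponents occurring in the distribution are non-negative. -/
def NonnegSupport (F : Distr s l) : Prop := ∀ β, F β ≠ 0 → ∀ i, 0 ≤ β i

theorem NonnegSupport.mulU {F : Distr s l} (hF : NonnegSupport F) (i : Fin l) :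
    NonnegSupport (mulU i F) := by
  intro β hβ j
  have h1 := hF _ hβ j
  change 0 ≤ β j - (Pi.single i 1 : Fin l → ℤ) j at h1
  have h2 : (0 : ℤ) ≤ (Pi.single i 1 : Fin l → ℤ) j := by
    rw [Pi.single_apply]
    split_ifs <;> norm_num
  omega

theorem NonnegSupport.mulDiff {F : Distr s l} (hF : NonnegSupport F) (a : Fin l → Fin s)
    (j i : Fin l) : NonnegSupport (mulDiff a j i F) := by
  rw [MultiKP.mulDiff]
  split_ifs
  · intro β hβ
    by_cases h : MultiKP.mulU i F β = 0
    · refine hF.mulU j β fun h' => hβ ?_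
      rw [LinearMap.sub_apply, Pi.sub_apply, h, h', sub_zero]
    · exact hF.mulU i β h
  · exact hF

theorem NonnegSupport.pairProd {F : Distr s l} (hF : NonnegSupport F) (a : Fin l → Fin s)
    (L : List (Fin l)) : NonnegSupport (pairProd (MultiKP.mulDiff a) L F) := by
  induction L with
  | nil => exact hF
  | cons i L ih =>
    rw [MultiKP.pairProd, Module.End.mul_apply]
    generalize hG : MultiKP.pairProd (MultiKP.mulDiff a) L F = G at ih
    clear hG
    induction L with
    | nil => exact ih
    | cons j L ih' => exact ih'.mulDiff a j i

theorem nonnegSupport_prodH_decr (a : Fin l → Fin s) : NonnegSupport (prodH a (decr l)) := by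
  intro β hβ i
  by_contra hi
  refine hβ ?_
  rw [prodH_apply, prod_map_decr]
  exact Finset.prod_eq_zero (Finset.mem_univ i) (expInt_of_neg _ (not_le.mp hi))

/-- The series `A_j` are separated from the series `H`, whose product with the differences
`u_j - u_i` has no negative exponents; therefore a finite box of exponents suffices. -/
theorem coeff_Tcolour (A : Fin l → Fin s → LaurentSeries ℂ) (a : Fin l → Fin s) (α : Fin l → ℤ)
    {N : ℤ} (hN : ∀ i r k, k ≤ α i - N → (A i r).coeff k = 0) :
    (Tcolour A a).coeff α = ∑ n ∈ Fintype.piFinset fun _ : Fin l => Finset.Ico 0 N,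
      (∏ j, (A j (a j)).coeff (α j - n j)) •
        pairProd (mulDiff a) (decr l) (prodH a (decr l)) n := by
  have hfac : Tcolour A a = (∏ j, substVar j ((A j (a j)).map (algebraMap ℂ (Sym s)))) *
      (pairProd (diffFactor a) (decr l) *
        ∏ j, substVar j (HahnSeries.ofPowerSeries ℤ (Sym s) (PowerSeries.mk (h (a j))))) := by
    rw [pairProd_reverse_finRange, mul_left_comm, ← Finset.prod_mul_distrib]
    simp only [← map_mul]
    rfl
  have hH : (∏ j, substVar j (HahnSeries.ofPowerSeries ℤ (Sym s)
      (PowerSeries.mk (h (a j)))) : MultiLaurent l (Sym s)).coeff = prodH a (decr l) := by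
    funext β
    rw [coeff_prod_substVar, prodH_apply, prod_map_decr]
    simp only [coeff_H]
  have hA : ∀ β : Fin l → ℤ, (∏ j, substVar j ((A j (a j)).map (algebraMap ℂ (Sym s))) :
      MultiLaurent l (Sym s)).coeff β = algebraMap ℂ (Sym s) (∏ j, (A j (a j)).coeff (β j)) := by
    intro β
    rw [coeff_prod_substVar, map_prod]
    rfl
  rw [hfac, coeff_mul_eq_sum _ _ α (Fintype.piFinset fun _ : Fin l => Finset.Ico 0 N),
    coeff_pairProd_diffFactor_mul, hH]
  · refine Finset.sum_congr rfl fun n _ => ?_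
    rw [hA, Algebra.smul_def]
    rfl
  · intro n hn
    rw [coeff_pairProd_diffFactor_mul, hH, hA]
    by_cases h0 : pairProd (mulDiff a) (decr l) (prodH a (decr l)) n = 0
    · rw [h0, mul_zero]
    · have h1 := (nonnegSupport_prodH_decr a).pairProd a (decr l) n h0
      rw [Fintype.mem_piFinset, not_forall] at hn
      obtain ⟨i, hi⟩ := hn
      rw [Finset.mem_Ico, not_and, not_lt] at hi
      have h2 := hi (h1 i)
      rw [Finset.prod_eq_zero (Finset.mem_univ i), map_zero, zero_mul]
      refine hN i _ _ ?_
      simp only [Pi.sub_apply]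
      omega

theorem weight_decr (a : Fin l → Fin s) : weight a (decr l) = ∑ i, Pi.single (a i) 1 :=
  sum_map_decr _

theorem prod_z (a : Fin l → Fin s) :
    ∏ i, z (a i) = (AddMonoidAlgebra.single (weight a (decr l)) 1 : Fock s) := by
  rw [weight_decr]
  have h1 : ∀ S : Finset (Fin l), ∏ i ∈ S, z (a i) =
      (AddMonoidAlgebra.single (∑ i ∈ S, Pi.single (a i) 1) 1 : Fock s) := by
    intro S
    induction S using Finset.induction with
    | empty => rfl
    | insert i S hi ih =>
      rw [Finset.prod_insert hi, ih, Finset.sum_insert hi, z, AddMonoidAlgebra.single_mul_single,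
        one_mul]
  exact h1 Finset.univ

theorem epsSeq_eq (a : Fin l → Fin s) : epsSeq a = eps ((decr l).map a) := by
  rw [epsSeq, List.map_reverse, List.ofFn_eq_map]

/-- The coefficient of `u^α` in `T`, as a sum over the colours `a_1, …, a_l`. -/
theorem coeff_T (A : Fin l → Fin s → LaurentSeries ℂ) (α : Fin l → ℤ) :
    (T A).coeff α = ∑ a : Fin l → Fin s, ((epsSeq a : ℤ) : ℂ) •
      AddMonoidAlgebra.single (weight a (decr l)) ((Tcolour A a).coeff α) := by
  rw [T, HahnSeries.coeff_sum]
  refine Finset.sum_congr rfl fun a _ => ?_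
  rw [HahnSeries.C_mul_eq_smul, HahnSeries.coeff_smul, HahnSeries.map_coeff, prod_z, smul_eq_mul,
    mul_assoc]
  have h1 : algebraMap (Sym s) (Fock s) ((Tcolour A a).coeff α) =
      AddMonoidAlgebra.single 0 ((Tcolour A a).coeff α) := rfl
  rw [h1, AddMonoidAlgebra.single_mul_single, add_zero, one_mul, Int.cast_smul_eq_zsmul,
    zsmul_eq_mul]

/-- Expansion of a product of finite sums in a non-commutative algebra. -/
theorem list_prod_sum_smul {E κ : Type*} [Ring E] [Algebra ℂ E] (K : Finset κ)
    (c : Fin l → κ → ℂ) (g : κ → E) :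
    ((decr l).map fun i => ∑ x ∈ K, c i x • g x).prod =
      ∑ r ∈ Fintype.piFinset fun _ : Fin l => K,
        (∏ i, c i (r i)) • ((decr l).map fun i => g (r i)).prod := by
  have hrev : ∀ v : Fin l → E,
      ((MultilinearMap.mkPiAlgebraFin ℂ l E).domDomCongr Fin.revPerm) v =
        ((decr l).map v).prod := by
    intro v
    rw [MultilinearMap.domDomCongr_apply, MultilinearMap.mkPiAlgebraFin_apply, List.ofFn_eq_map,
      decr, List.finRange_reverse, List.map_map]
    rfl
  rw [← hrev, MultilinearMap.map_sum_finset]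
  refine Finset.sum_congr rfl fun r _ => ?_
  rw [MultilinearMap.map_smul_univ, hrev]

/-- `∑_a ∑_{0 ≤ n < N} A_i⁽ᵃ⁾_{α_i - n} ψ⁺⁽ᵃ⁾_n`: the coefficient of `u^{α_i}` in
`∑_a A_i⁽ᵃ⁾(u) ψ⁺⁽ᵃ⁾(u)`, without the modes that kill the vacuum. -/
noncomputable def fieldCoeff (A : Fin l → Fin s → LaurentSeries ℂ) (α : Fin l → ℤ) (N : ℤ)
    (i : Fin l) : (Fin s × ℤ) →₀ ℂ :=
  Finsupp.onFinset (Finset.univ ×ˢ Finset.Ico 0 N)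
    (fun x => if x ∈ (Finset.univ : Finset (Fin s)) ×ˢ Finset.Ico 0 N then
      (A i x.1).coeff (α i - x.2) else 0) fun _ hx => by
        by_contra h0
        exact hx (if_neg h0)

theorem fermion_fieldCoeff (A : Fin l → Fin s → LaurentSeries ℂ) (α : Fin l → ℤ) (N : ℤ)
    (i : Fin l) : fermion (fieldCoeff A α N i) =
      ∑ x ∈ (Finset.univ : Finset (Fin s)) ×ˢ Finset.Ico 0 N,
        (A i x.1).coeff (α i - x.2) • psiPlus x.1 x.2 := by
  rw [fermion, fieldCoeff, Finsupp.onFinset_sum (g := fun (x : Fin s × ℤ) (r : ℂ) =>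
    (r • psiPlus x.1 x.2 : Module.End ℂ (Fock s))) _ fun _ => zero_smul ℂ _]
  exact Finset.sum_congr rfl fun x hx => by rw [if_pos hx]

/-- The coefficients of `T(u_1, …, u_l)` are obtained from the vacuum by applying `l` fermions. -/
theorem coeff_T_eq_list_prod (A : Fin l → Fin s → LaurentSeries ℂ) (α : Fin l → ℤ)
    {N : ℤ} (hN : ∀ i r k, k ≤ α i - N → (A i r).coeff k = 0) :
    (T A).coeff α =
      ((decr l).map fun i => fermion (fieldCoeff A α N i)).prod (1 : Fock s) := by
  have hnodup : (decr l).Nodup := List.nodup_reverse.mpr (List.nodup_finRange l)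
  simp only [fermion_fieldCoeff]
  rw [list_prod_sum_smul _ (fun i (x : Fin s × ℤ) => (A i x.1).coeff (α i - x.2))
    fun x => (psiPlus x.1 x.2 : Module.End ℂ (Fock s)), coeff_T,
    LinearMap.sum_apply]
  have hterm : ∀ a : Fin l → Fin s, ((epsSeq a : ℤ) : ℂ) •
      AddMonoidAlgebra.single (weight a (decr l)) ((Tcolour A a).coeff α) =
      ∑ n ∈ Fintype.piFinset fun _ : Fin l => Finset.Ico 0 N,
        (∏ j, (A j (a j)).coeff (α j - n j)) •
          ((decr l).map fun i => psiPlus (a i) (n i)).prod (1 : Fock s) := by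
    intro a
    have hsum := map_sum (AddMonoidAlgebra.lsingle (weight a (decr l)) : Sym s →ₗ[ℂ] Fock s)
      (fun n => (∏ j, (A j (a j)).coeff (α j - n j)) •
        pairProd (mulDiff a) (decr l) (prodH a (decr l)) n)
      (Fintype.piFinset fun _ : Fin l => Finset.Ico 0 N)
    simp only [AddMonoidAlgebra.lsingle_apply] at hsum
    rw [coeff_Tcolour A a α hN, hsum, Finset.smul_sum]
    refine Finset.sum_congr rfl fun n _ => ?_
    rw [list_prod_psiPlus_one a hnodup, epsSeq_eq]
    simp only [AddMonoidAlgebra.smul_single]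
    rw [smul_comm]
  rw [Finset.sum_congr rfl fun a _ => hterm a, ← Finset.sum_product']
  refine Finset.sum_nbij' (fun q i => (q.1 i, q.2 i)) (fun r => (fun i => (r i).1, fun i => (r i).2))
    ?_ ?_ (fun _ _ => rfl) (fun _ _ => rfl) fun _ _ => rfl
  · intro q hq
    rw [Finset.mem_product, Fintype.mem_piFinset] at hq
    rw [Fintype.mem_piFinset]
    exact fun i => Finset.mem_product.mpr ⟨Finset.mem_univ _, hq.2 i⟩
  · intro r hr
    rw [Fintype.mem_piFinset] at hr
    rw [Finset.mem_product, Fintype.mem_piFinset]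
    exact ⟨Finset.mem_univ _, fun i => (Finset.mem_product.mp (hr i)).2⟩

/-- A common bound for the exponents that occur in the finitely many series `A_i⁽ʳ⁾`. -/
theorem exists_coeff_bound (A : Fin l → Fin s → LaurentSeries ℂ) (α : Fin l → ℤ) :
    ∃ N : ℤ, ∀ i r k, k ≤ α i - N → (A i r).coeff k = 0 := by
  refine ⟨∑ i, ∑ r, (|α i - (A i r).order| + 1) + 1, fun i r k hk => ?_⟩
  refine HahnSeries.coeff_eq_zero_of_lt_order (lt_of_le_of_lt hk ?_)
  have h1 : |α i - (A i r).order| + 1 ≤ ∑ r, (|α i - (A i r).order| + 1) :=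
    Finset.single_le_sum (f := fun r => |α i - (A i r).order| + 1)
      (fun _ _ => by positivity) (Finset.mem_univ r)
  have h2 : ∑ r, (|α i - (A i r).order| + 1) ≤ ∑ i, ∑ r, (|α i - (A i r).order| + 1) :=
    Finset.single_le_sum (f := fun i => ∑ r, (|α i - (A i r).order| + 1))
      (fun _ _ => Finset.sum_nonneg fun _ _ => by positivity) (Finset.mem_univ i)
  have h3 := le_abs_self (α i - (A i r).order)
  omega

theorem Omega_coeff_T (A : Fin l → Fin s → LaurentSeries ℂ) (α : Fin l → ℤ) :
    Omega s ((T A).coeff α ⊗ₜ[ℂ] (T A).coeff α) = 0 := by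
  obtain ⟨N, hN⟩ := exists_coeff_bound A α
  rw [coeff_T_eq_list_prod A α hN]
  have := Omega_list_prod_fermion ((decr l).map (fieldCoeff A α N))
  rwa [List.map_map] at this

end Generating

/-! ### The determinant formula -/

section Determinant

variable {s l : ℕ}

/-- The bijection of `{(r, k) : 1 ≤ k ≤ m_r}` with `{1, …, l}` that lists the blocks of lengths
`m_1, …, m_s` one after the other. -/
def blockEquiv (m : Fin s → ℕ) (hm : ∑ r, m r = l) : (Σ r, Fin (m r)) ≃ Fin l :=
  finSigmaFinEquiv.trans (finCongr hm)

theorem colour_blockEquiv (m : Fin s → ℕ) (hm : ∑ r, m r = l) (x : Σ r, Fin (m r)) :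
    colour m hm (blockEquiv m hm x) = x.1 := by
  have h : Fin.cast hm.symm (blockEquiv m hm x) = finSigmaFinEquiv x := Fin.ext rfl
  rw [colour, h, Equiv.symm_apply_apply]

theorem partialSum_succ (m : Fin s → ℕ) (r : Fin s) :
    partialSum m (r + 1) = partialSum m r + m r := by
  have h : Finset.univ.filter (fun a : Fin s => (a : ℕ) < r + 1) =
      insert r (Finset.univ.filter fun a : Fin s => (a : ℕ) < r) := by
    ext a
    simp only [Finset.mem_filter, Finset.mem_univ, true_and, Finset.mem_insert, Fin.ext_iff]
    omega
  rw [partialSum, h, Finset.sum_insert (by simp), add_comm]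
  rfl

theorem partialSum_mono (m : Fin s → ℕ) {i j : ℕ} (hij : i ≤ j) :
    partialSum m i ≤ partialSum m j :=
  Finset.sum_le_sum_of_subset fun a ha => by
    rw [Finset.mem_filter] at ha ⊢
    exact ⟨ha.1, lt_of_lt_of_le ha.2 hij⟩

theorem blockEquiv_val (m : Fin s → ℕ) (hm : ∑ r, m r = l) (x : Σ r, Fin (m r)) :
    (blockEquiv m hm x : ℕ) = partialSum m x.1 + x.2 := by
  have h : (blockEquiv m hm x : ℕ) = (finSigmaFinEquiv x : ℕ) := rfl
  rw [h, finSigmaFinEquiv_apply, partialSum]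
  congr 1
  refine Finset.sum_bij (fun i _ => Fin.castLE x.1.2.le i) (fun i _ => ?_) (fun i _ j _ hij => ?_)
    (fun a ha => ?_) fun _ _ => rfl
  · exact Finset.mem_filter.mpr ⟨Finset.mem_univ _, i.2⟩
  · exact Fin.castLE_injective _ hij
  · exact ⟨⟨a, (Finset.mem_filter.mp ha).2⟩, Finset.mem_univ _, rfl⟩

/-- `σ_m` of the `k`-th position of a block is `k` (here `k = x.2 + 1`). -/
theorem sigma_blockEquiv (m : Fin s → ℕ) (hm : ∑ r, m r = l) (x : Σ r, Fin (m r)) :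
    sigma m ((blockEquiv m hm x : ℕ) + 1) = x.2 + 1 := by
  have h : ((Finset.range s).filter
      (fun r => partialSum m r < (blockEquiv m hm x : ℕ) + 1)).sup (partialSum m) =
      partialSum m x.1 := by
    rw [blockEquiv_val]
    refine le_antisymm (Finset.sup_le fun r hr => ?_) (Finset.le_sup (f := partialSum m) ?_)
    · rw [Finset.mem_filter] at hr
      by_contra hlt
      have h1 : (x.1 : ℕ) + 1 ≤ r := by
        by_contra h2
        exact hlt (partialSum_mono m (by omega))
      have h2 := partialSum_mono m h1
      rw [partialSum_succ] at h2
      have h3 := x.2.2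
      omega
    · rw [Finset.mem_filter, Finset.mem_range]
      exact ⟨x.1.2, by omega⟩
  rw [sigma, h, blockEquiv_val]
  omega

theorem blockEquiv_lt_of_fst_lt (m : Fin s → ℕ) (hm : ∑ r, m r = l) {x y : Σ r, Fin (m r)}
    (hxy : x.1 < y.1) : blockEquiv m hm x < blockEquiv m hm y := by
  rw [Fin.lt_def, blockEquiv_val, blockEquiv_val]
  have h1 := partialSum_succ m x.1
  have h2 := partialSum_mono m (show (x.1 : ℕ) + 1 ≤ y.1 from hxy)
  have h3 := x.2.2
  omega

theorem blockEquiv_lt_iff (m : Fin s → ℕ) (hm : ∑ r, m r = l) (r : Fin s) (k k' : Fin (m r)) :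
    blockEquiv m hm ⟨r, k⟩ < blockEquiv m hm ⟨r, k'⟩ ↔ k < k' := by
  rw [Fin.lt_def, blockEquiv_val, blockEquiv_val, Fin.lt_def]
  simp

variable {R : Type*} [CommRing R]

/-- The antisymmetric expression in `(a_i, u_i)` and `(a_j, u_j)` whose product over `i < j` is
`ε(a_l, …, a_1) ∏_{i<j} (u_j - u_i)^{δ_{a_i, a_j}}`. -/
def signedDiff (a : Fin l → Fin s) (u : Fin l → R) (i j : Fin l) : R :=
  if a i = a j then u j - u i else if a i < a j then -1 else 1

theorem signedDiff_antisymm (a : Fin l → Fin s) (u : Fin l → R) (i j : Fin l) :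
    signedDiff a u i j = -signedDiff a u j i := by
  rw [signedDiff, signedDiff]
  rcases lt_trichotomy (a i) (a j) with h | h | h
  · rw [if_neg h.ne, if_pos h, if_neg h.ne', if_neg h.not_gt]
  · rw [if_pos h, if_pos h.symm, neg_sub]
  · rw [if_neg h.ne', if_neg h.not_gt, if_neg h.ne, if_pos h, neg_neg]

/-- The rows `(u_i^{σ_m(j) - 1} δ_{a_i, c_j})_j` where `c` is the sorted sequence of colours. -/
def colourMatrix (m : Fin s → ℕ) (hm : ∑ r, m r = l) (a : Fin l → Fin s) (u : Fin l → R) :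
    Matrix (Fin l) (Fin l) R :=
  Matrix.of fun i j => if a i = colour m hm j then u i ^ (sigma m ((j : ℕ) + 1) - 1) else 0

theorem det_blockDiagonal' {o : Type*} [LinearOrder o] [Fintype o]
    {n : o → Type*} [∀ i, Fintype (n i)] [∀ i, DecidableEq (n i)]
    (M : ∀ i, Matrix (n i) (n i) R) :
    (Matrix.blockDiagonal' M).det = ∏ i, (M i).det := by
  rw [(Matrix.blockTriangular_blockDiagonal' M).det_fintype]
  refine Finset.prod_congr rfl fun i _ => ?_
  rw [← Matrix.det_submatrix_equiv_self (Equiv.sigmaSubtype i).symm]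
  congr 1
  ext k k'
  exact Matrix.blockDiagonal'_apply_eq M i k k'

theorem det_colourMatrix_colour (m : Fin s → ℕ) (hm : ∑ r, m r = l) (u : Fin l → R) :
    (colourMatrix m hm (colour m hm) u).det =
      ∏ r, ∏ k : Fin (m r), ∏ k' ∈ Finset.Ioi k,
        (u (blockEquiv m hm ⟨r, k'⟩) - u (blockEquiv m hm ⟨r, k⟩)) := by
  have h : (colourMatrix m hm (colour m hm) u).submatrix (blockEquiv m hm) (blockEquiv m hm) =
      Matrix.blockDiagonal' fun r =>
        Matrix.vandermonde fun k : Fin (m r) => u (blockEquiv m hm ⟨r, k⟩) := by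
    ext ⟨r, k⟩ ⟨r', k'⟩
    rw [Matrix.submatrix_apply, colourMatrix, Matrix.of_apply, colour_blockEquiv,
      colour_blockEquiv, sigma_blockEquiv, Nat.add_sub_cancel]
    by_cases hr : r = r'
    · subst hr
      rw [if_pos rfl, Matrix.blockDiagonal'_apply_eq, Matrix.vandermonde_apply]
    · rw [if_neg hr, Matrix.blockDiagonal'_apply_ne _ _ _ hr]
  rw [← Matrix.det_submatrix_equiv_self (blockEquiv m hm), h, det_blockDiagonal']
  exact Finset.prod_congr rfl fun r _ => Matrix.det_vandermonde _

/-- For the sorted colouring, pairs of equal colour contribute Vandermonde determinants and the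
`m_i m_j` pairs of colours `i < j` contribute `-1` each. -/
theorem prod_signedDiff_colour (m : Fin s → ℕ) (hm : ∑ r, m r = l) (u : Fin l → R) :
    ∏ i, ∏ j ∈ Finset.Ioi i, signedDiff (colour m hm) u i j =
      (-1) ^ (∑ i : Fin s, ∑ j ∈ Finset.Ioi i, m i * m j) *
        (colourMatrix m hm (colour m hm) u).det := by
  set e := blockEquiv m hm with he
  have h1 : ∏ i, ∏ j ∈ Finset.Ioi i, signedDiff (colour m hm) u i j =
      ∏ r : Fin s, ∏ r' : Fin s, ∏ k : Fin (m r), ∏ k' : Fin (m r'),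
        if e ⟨r, k⟩ < e ⟨r', k'⟩ then signedDiff (colour m hm) u (e ⟨r, k⟩) (e ⟨r', k'⟩) else 1 := by
    have h2 : ∀ i : Fin l, ∏ j ∈ Finset.Ioi i, signedDiff (colour m hm) u i j =
        ∏ j, if i < j then signedDiff (colour m hm) u i j else 1 := by
      intro i
      rw [← Finset.prod_filter]
      congr 1
      ext j
      simp
    have h4 : ∀ f : Fin l → R, ∏ j, f j = ∏ r : Fin s, ∏ k : Fin (m r), f (e ⟨r, k⟩) := by
      intro f
      rw [← e.prod_comp, Fintype.prod_sigma]
    rw [Finset.prod_congr rfl fun i _ => h2 i, h4]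
    refine Finset.prod_congr rfl fun r _ => ?_
    rw [Finset.prod_congr rfl fun k _ => h4 _, Finset.prod_comm]
  have h3 : ∀ r r' : Fin s, (∏ k : Fin (m r), ∏ k' : Fin (m r'),
      if e ⟨r, k⟩ < e ⟨r', k'⟩ then signedDiff (colour m hm) u (e ⟨r, k⟩) (e ⟨r', k'⟩) else 1) =
      (if r' = r then ∏ k : Fin (m r), ∏ k' ∈ Finset.Ioi k, (u (e ⟨r, k'⟩) - u (e ⟨r, k⟩)) else 1) *
        if r < r' then (-1) ^ (m r * m r') else 1 := by
    intro r r'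
    simp only [signedDiff, he, colour_blockEquiv]
    rcases lt_trichotomy r r' with h | h | h
    · rw [if_neg h.ne', if_pos h, one_mul]
      simp only [if_pos (blockEquiv_lt_of_fst_lt m hm (x := ⟨r, _⟩) (y := ⟨r', _⟩) h),
        if_neg h.ne, if_pos h, Finset.prod_const, Finset.card_univ, Fintype.card_fin]
      rw [← pow_mul, mul_comm]
    · subst h
      simp only [if_true, lt_irrefl, if_false, mul_one, blockEquiv_lt_iff]
      refine Finset.prod_congr rfl fun k _ => ?_
      rw [← Finset.prod_filter]
      congr 1
      ext k'
      simp
    · rw [if_neg h.ne, if_neg h.not_gt, one_mul]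
      simp only [if_neg h.ne', if_neg h.not_gt, ite_self, Finset.prod_const_one]
  rw [h1, det_colourMatrix_colour]
  simp only [h3, Finset.prod_mul_distrib]
  rw [mul_comm, ← Finset.prod_pow_eq_pow_sum]
  congr 1
  · refine Finset.prod_congr rfl fun r _ => ?_
    rw [← Finset.prod_pow_eq_pow_sum, ← Finset.prod_filter]
    refine Finset.prod_congr ?_ fun _ _ => rfl
    ext r'
    simp
  · refine Finset.prod_congr rfl fun r _ => ?_
    rw [Finset.prod_ite_eq' Finset.univ r, if_pos (Finset.mem_univ r)]

theorem weight_decr_apply (a : Fin l → Fin s) (r : Fin s) :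
    weight a (decr l) r = Fintype.card {i // a i = r} := by
  rw [weight_decr, Finset.sum_apply, Fintype.card_subtype, Finset.card_filter]
  push_cast
  refine Finset.sum_congr rfl fun i _ => ?_
  rw [Pi.single_apply]
  exact if_congr eq_comm rfl rfl

theorem card_colour (m : Fin s → ℕ) (hm : ∑ r, m r = l) (r : Fin s) :
    Fintype.card {j // colour m hm j = r} = m r := by
  have e1 : {x : Σ r, Fin (m r) // x.1 = r} ≃ {j // colour m hm j = r} :=
    (blockEquiv m hm).subtypeEquiv fun x => by rw [colour_blockEquiv]
  rw [← Fintype.card_congr e1, Fintype.card_congr (Equiv.sigmaSubtype r), Fintype.card_fin]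

theorem exists_perm_of_weight {m : Fin s → ℕ} {hm : ∑ r, m r = l} {a : Fin l → Fin s}
    (ha : weight a (decr l) = fun r => (m r : ℤ)) :
    ∃ π : Equiv.Perm (Fin l), ∀ i, colour m hm (π i) = a i := by
  have hcard : ∀ r, Nonempty ({i // a i = r} ≃ {j // colour m hm j = r}) := by
    intro r
    refine ⟨Fintype.equivOfCardEq ?_⟩
    have h1 := congrFun ha r
    rw [weight_decr_apply] at h1
    rw [card_colour]
    exact_mod_cast h1
  exact ⟨Equiv.ofFiberEquiv fun r => (hcard r).some, Equiv.ofFiberEquiv_map _⟩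

/-- Both sides change by the sign of the permutation when the pairs `(a_i, u_i)` are permuted, so
that it suffices to compare them for the sorted sequence of colours. -/
theorem prod_signedDiff {m : Fin s → ℕ} {hm : ∑ r, m r = l} {a : Fin l → Fin s}
    (ha : weight a (decr l) = fun r => (m r : ℤ)) (u : Fin l → R) :
    ∏ i, ∏ j ∈ Finset.Ioi i, signedDiff a u i j =
      (-1) ^ (∑ i : Fin s, ∑ j ∈ Finset.Ioi i, m i * m j) * (colourMatrix m hm a u).det := by
  obtain ⟨π, hπ⟩ := exists_perm_of_weight (hm := hm) ha
  have h1 : ∀ i j, signedDiff a u i j =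
      signedDiff (colour m hm) (fun i => u (π.symm i)) (π i) (π j) := by
    intro i j
    simp only [signedDiff, hπ, Equiv.symm_apply_apply]
  have h2 : colourMatrix m hm a u =
      (colourMatrix m hm (colour m hm) fun i => u (π.symm i)).submatrix π id := by
    ext i j
    simp only [colourMatrix, Matrix.submatrix_apply, Matrix.of_apply, hπ, Equiv.symm_apply_apply,
      id_eq]
  simp only [h1]
  rw [Equiv.Perm.prod_Ioi_comp_eq_sign_mul_prod π
    (signedDiff_antisymm (colour m hm) fun i => u (π.symm i)), prod_signedDiff_colour, h2,
    Matrix.det_permute, mul_left_comm]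

/-- If the colouring `a` does not have `m_r` entries `r`, no permutation matches it with the sorted
colouring, and all terms of the determinant vanish. -/
theorem det_colourMatrix_eq_zero {m : Fin s → ℕ} {hm : ∑ r, m r = l} {a : Fin l → Fin s}
    (ha : weight a (decr l) ≠ fun r => (m r : ℤ)) (u : Fin l → R) :
    (colourMatrix m hm a u).det = 0 := by
  rw [Matrix.det_apply]
  refine Finset.sum_eq_zero fun π _ => ?_
  have h1 : ∃ i, a (π i) ≠ colour m hm i := by
    by_contra! h
    refine ha (funext fun r => ?_)
    rw [weight_decr_apply, ← card_colour m hm r]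
    exact_mod_cast (Fintype.card_congr (π.subtypeEquiv fun i => by rw [h i])).symm
  obtain ⟨i, hi⟩ := h1
  rw [Finset.prod_eq_zero (Finset.mem_univ i), smul_zero]
  exact if_neg hi

theorem eps_eq_pairProd (a : Fin l → Fin s) (L : List (Fin l)) :
    eps (L.map a) = pairProd (fun i j => if a i < a j then -1 else 1) L := by
  induction L with
  | nil => rfl
  | cons i L ih =>
    rw [List.map_cons, eps, pairProd, ih]
    congr 1
    clear ih
    induction L with
    | nil => rfl
    | cons j L ih =>
      rw [List.map_cons, List.countP_cons, List.map_cons, List.prod_cons, ← ih, pow_add, mul_comm]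
      congr 1
      by_cases h : a j < a i <;> simp [h]

theorem epsSeq_mul_Tcolour (A : Fin l → Fin s → LaurentSeries ℂ) (a : Fin l → Fin s) :
    ((epsSeq a : ℤ) : MultiLaurent l (Sym s)) * Tcolour A a =
      (∏ i, ∏ j ∈ Finset.Ioi i, signedDiff a (fun i => uPow i 1) i j) *
        ∏ j, substVar j (Tone A j (a j)) := by
  rw [epsSeq_eq, eps_eq_pairProd, pairProd_reverse_finRange, Tcolour, ← mul_assoc]
  congr 1
  simp only [Int.cast_prod, ← Finset.prod_mul_distrib]
  refine Finset.prod_congr rfl fun i _ => Finset.prod_congr rfl fun j _ => ?_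
  rw [signedDiff]
  by_cases h : a i = a j
  · rw [if_pos h, if_pos h, if_neg (by rw [h]; exact lt_irrefl _), Int.cast_one, one_mul]
  · rw [if_neg h, if_neg h, mul_one]
    split_ifs <;> simp

theorem uPow_natCast {S : Type} [CommRing S] (i : Fin l) (n : ℕ) :
    uPow (R := S) i (n : ℤ) = uPow i 1 ^ n := by
  rw [uPow, uPow, HahnSeries.single_pow, one_pow]
  congr 1
  rw [← Pi.single_smul]
  simp

theorem one_le_sigma (m : Fin s → ℕ) (hm : ∑ r, m r = l) (j : Fin l) :
    1 ≤ sigma m ((j : ℕ) + 1) := by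
  obtain ⟨x, rfl⟩ := (blockEquiv m hm).surjective j
  rw [sigma_blockEquiv]
  omega

/-- The determinant expanded by multilinearity in the rows, each of which is a sum over colours. -/
theorem Tdet_eq_sum (A : Fin l → Fin s → LaurentSeries ℂ) (m : Fin s → ℕ) (hm : ∑ r, m r = l) :
    Tdet A m hm = ∑ a : Fin l → Fin s,
      if weight a (decr l) = fun r => (m r : ℤ) then
        ((epsSeq a : ℤ) : MultiLaurent l (Sym s)) * Tcolour A a else 0 := by
  have hrow : (Matrix.of fun i j : Fin l => uPow i ((sigma m ((j : ℕ) + 1) : ℤ) - 1) *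
      substVar i (Tone A i (colour m hm j)) : Matrix (Fin l) (Fin l) (MultiLaurent l (Sym s))) =
      fun i => ∑ r : Fin s, substVar i (Tone A i r) • fun j : Fin l =>
        if r = colour m hm j then (uPow i 1 : MultiLaurent l (Sym s)) ^ (sigma m ((j : ℕ) + 1) - 1)
          else 0 := by
    funext i j
    have h1 := one_le_sigma m hm j
    rw [Matrix.of_apply, Finset.sum_apply]
    simp only [Pi.smul_apply, smul_eq_mul, mul_ite, mul_zero]
    rw [Finset.sum_ite_eq', if_pos (Finset.mem_univ _), mul_comm, ← uPow_natCast,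
      Nat.cast_sub h1, Nat.cast_one]
  rw [Tdet, hrow]
  change _ * (Matrix.detRowAlternating.toMultilinearMap fun i : Fin l => _) = _
  rw [MultilinearMap.map_sum, Finset.mul_sum]
  refine Finset.sum_congr rfl fun a _ => ?_
  rw [MultilinearMap.map_smul_univ]
  change _ * _ • (colourMatrix m hm a fun i => uPow i 1).det = _
  split_ifs with ha
  · rw [epsSeq_mul_Tcolour, prod_signedDiff (hm := hm) ha, smul_eq_mul, mul_left_comm, mul_comm]
  · rw [det_colourMatrix_eq_zero ha, smul_zero, mul_zero]

theorem coeff_coeff_T (A : Fin l → Fin s → LaurentSeries ℂ) (α : Fin l → ℤ) (m : Fin s → ℤ) :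
    ((T A).coeff α).coeff m = ∑ a : Fin l → Fin s,
      if weight a (decr l) = m then ((epsSeq a : ℤ) : ℂ) • (Tcolour A a).coeff α else 0 := by
  rw [coeff_T, AddMonoidAlgebra.coeff_sum, Finsupp.finsetSum_apply]
  refine Finset.sum_congr rfl fun a _ => ?_
  rw [AddMonoidAlgebra.coeff_smul_apply, AddMonoidAlgebra.coeff_single, Finsupp.single_apply,
    smul_ite, smul_zero]

end Determinant

end MultiKP

theorem mainTheorem4 (s l : ℕ) (hs : 0 < s)
    (A : Fin l → Fin s → LaurentSeries ℂ) (α : Fin l → ℤ) :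
    ((MultiKP.T A).coeff α ≠ 0 →
      MultiKP.IsTauFunction (l : ℤ) ((MultiKP.T A).coeff α)) ∧
    (∀ (m : Fin s → ℕ) (hm : ∑ r, m r = l),
      ((MultiKP.T A).coeff α).coeff (fun r => (m r : ℤ)) = (MultiKP.Tdet A m hm).coeff α) ∧
    (∀ m : Fin s → ℤ, (¬ ((∀ r, 0 ≤ m r) ∧ ∑ r, m r = (l : ℤ))) →
      ((MultiKP.T A).coeff α).coeff m = 0) := by
  have hzero : ∀ m : Fin s → ℤ, (¬ ((∀ r, 0 ≤ m r) ∧ ∑ r, m r = (l : ℤ))) →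
      ((MultiKP.T A).coeff α).coeff m = 0 := by
    intro m hm
    rw [MultiKP.coeff_coeff_T]
    refine Finset.sum_eq_zero fun a _ => if_neg ?_
    rintro rfl
    refine hm ⟨fun r => ?_, ?_⟩
    · rw [MultiKP.weight_decr_apply]
      positivity
    · simp only [MultiKP.weight_decr, Finset.sum_apply]
      rw [Finset.sum_comm]
      simp
  refine ⟨fun h => ⟨h, fun m hm => ?_, MultiKP.Omega_coeff_T A α⟩, fun m hm => ?_, hzero⟩
  · by_contra hc
    exact hm (hzero m fun h' => hc h'.2)
  · rw [MultiKP.coeff_coeff_T, MultiKP.Tdet_eq_sum, HahnSeries.coeff_sum]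
    refine Finset.sum_congr rfl fun a _ => ?_
    split_ifs
    · rw [Int.cast_smul_eq_zsmul, ← zsmul_eq_mul]
      rfl
    · rfl
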